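/- Let $n\ge 1$ agents start at time $0$ at points $0\le Pos[1]<\dots<Pos[n]\le \ell$ of the segment $[0,\ell]$. A strategy gives every agent a finite sequence of movements with starting times; during a movement the agent walks at unit speed to some point of $[0,\ell]$, and between movements it waits. Each agent initially holds its own piece of information, and agents that are at the same point at the same time exchange all the information they hold. A strategy is a convergecast strategy using power at most $P$ if every agent travels a total distance of at most $P$ and at some time some agent holds the information of all agents. The optimal power $P^c_{OPT}$ is the least $P$ for which there is a convergecast strategy using power at most $P$. A regular convergecast strategy of power $P$ is given by an index $0\le p\le n$, which splits the agents into $LR=\{1,\dots,p\}$ and $RL=\{p+1,\dots,n\}$, and by points $b_i,f_i$ such that 1. for $i\in LR$: $b_i=\min\{f_{i-1},Pos[i]\}$ (with $b_1=Pos[1]$) and $f_i=2b_i+P-Pos[i]\ge b_i$; 2. for $i\in RL$: $b_i=\max\{f_{i+1},Pos[i]\}$ (with $b_n=Pos[n]$) and $f_i=2b_i-P-Pos[i]\le b_i$; 3. $\max_{i\in LR}f_i\ge\min_{i\in RL}f_i$ (if $RL=\emptyset$: $\max_{i\in LR} f_i\ge Pos[n]$; if $LR=\emptyset$: $\min_{i\in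 RL} f_i\le Pos[1]$). In its execution every agent $i$ first goes to $b_i$ and then, at a time $s_i$ at which it holds the information of agent $1$ (if $i\in LR$) or of agent $n$ (if $i\in RL$), leaves for $f_i$. **Theorem.** The optimal power $P^c_{OPT}$ exists, and there is a single program for a real-number random access machine (unit-cost arithmetic $+,-,\times,/$ and comparisons on reals; unit-cost addition, subtraction and comparison of natural-number indices; array access by computed index) which, on input $n$ and $Pos[1],\dots,Pos[n]$, halts after $O(n)$ steps and outputs $P^c_{OPT}$ together with an optimal convergecast strategy: an index $p$ and numbers $b_i,s_i,f_i$ $(1\le i\le n)$ describing a regular convergecast strategy of power $P^c_{OPT}$ whose movements, as above, form a convergecast strategy using power at most $P^c_{OPT}$. -/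

import Mathlib

/-! ## Mobile agents on a segment

The agents `0, …, n - 1` start at time `0` at the points `pos 0 < … < pos (n - 1)` of the segment
`[0, ℓ]`.  All of them move at unit speed. -/

namespace Convergecast

/-- One movement of an agent: from time `start` on, it walks at unit speed from its current
location to the point `target`. -/
structure Leg where
  start : ℝ
  target : ℝ

/-- A strategy gives every agent a finite sequence of movements. -/
abbrev Strategy (n : ℕ) := Fin n → List Leg

/-- The point reached from `x` after walking a distance `d` in the direction of `y`. -/
noncomputable def walk (x y d : ℝ) : ℝ := if x ≤ y then x + d else x - d

/-- The location at time `t` of an agent that is at `x` and executes the movements `L`.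
It waits before, between and after its movements. -/
noncomputable def location : ℝ → List Leg → ℝ → ℝ
  | x, [], _ => x
  | x, m :: L, t =>
      if t < m.start + |m.target - x| then walk x m.target (max 0 (t - m.start))
      else location m.target L t

/-- The movements `L` can be executed by an agent that is at `x` at time `T`: no movement starts
before the previous one has ended, and the agent stays in the segment `[0, ℓ]`. -/
def Feasible (ℓ : ℝ) : ℝ → ℝ → List Leg → Prop
  | _, _, [] => True
  | T, x, m :: L =>
      T ≤ m.start ∧ m.target ∈ Set.Icc 0 ℓ ∧
        Feasible ℓ (m.start + |m.target - x|) m.target L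

/-- The total distance travelled by an agent that starts at `x` and executes the movements `L`. -/
noncomputable def distance : ℝ → List Leg → ℝ
  | _, [] => 0
  | x, m :: L => |m.target - x| + distance m.target L

/-- The trajectories of the agents under a strategy. -/
noncomputable def trajectory {n : ℕ} (pos : Fin n → ℝ) (S : Strategy n) (i : Fin n) (t : ℝ) : ℝ :=
  location (pos i) (S i) t

/-- `Knows x i j t`: when the agents move along the trajectories `x`, agent `i` holds the initial
information of agent `j` at time `t`.  Every agent holds its own information from time `0` on,
information is never lost, and agents that are at the same point at the same time exchange
everything they hold. -/
inductive Knows {n : ℕ} (x : Fin n → ℝ → ℝ) : Fin n → Fin n → ℝ → Prop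
  | own (i : Fin n) : Knows x i i 0
  | keep {i j : Fin n} {s t : ℝ} : Knows x i j s → s ≤ t → Knows x i j t
  | meet {i k j : Fin n} {t : ℝ} : Knows x k j t → x i t = x k t → Knows x i j t

/-- `S` is a convergecast strategy for the configuration `pos` on `[0, ℓ]` using power at most `P`:
it can be executed, no agent travels a distance larger than `P`, and at some time some agent holds
the initial information of every agent. -/
structure IsConvergecast {n : ℕ} (ℓ : ℝ) (pos : Fin n → ℝ) (P : ℝ) (S : Strategy n) : Prop where
  feasible : ∀ i, Feasible ℓ 0 (pos i) (S i)
  power : ∀ i, distance (pos i) (S i) ≤ P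
  collect : ∃ (i : Fin n) (t : ℝ), ∀ j, Knows (trajectory pos S) i j t

/-- `P` is the optimal power for convergecast: the smallest power for which there is a
convergecast strategy. -/
def IsOptimalPower {n : ℕ} (ℓ : ℝ) (pos : Fin n → ℝ) (P : ℝ) : Prop :=
  IsLeast {Q : ℝ | ∃ S : Strategy n, IsConvergecast ℓ pos Q S} P

/-- The strategy in which agent `i` first goes to `b i` and then, at time `s i`, leaves
for `f i`. -/
def twoMoves {n : ℕ} (b s f : Fin n → ℝ) : Strategy n := fun i => [⟨0, b i⟩, ⟨s i, f i⟩]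

/-- The numbers `p`, `b`, `f`, together with the times `s`, describe a regular convergecast
strategy of power `P`.  The first `p` agents form the set `LR`; they carry the information of the
first agent to the right by a push strategy.  The other agents form the set `RL`; they carry the
information of the last agent to the left by a reverse push strategy.  Agent `i` first goes to
`b i`, and it leaves for `f i` at time `s i`, when it holds the information it has to carry. -/
structure IsRegular {n : ℕ} (pos : Fin n → ℝ) (P : ℝ) (p : ℕ) (b s f : Fin n → ℝ) : Prop where
  split_le : p ≤ n
  left_first : ∀ i : Fin n, i.val < p → i.val = 0 → b i = pos i
  left_next : ∀ i j : Fin n, i.val + 1 = j.val → j.val < p → b j = min (f i) (pos j)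
  left_end : ∀ i : Fin n, i.val < p → f i = 2 * b i + P - pos i ∧ b i ≤ f i
  right_last : ∀ i : Fin n, p ≤ i.val → i.val + 1 = n → b i = pos i
  right_next : ∀ i j : Fin n, i.val + 1 = j.val → p ≤ i.val → b i = max (f j) (pos i)
  right_end : ∀ i : Fin n, p ≤ i.val → f i = 2 * b i - P - pos i ∧ f i ≤ b i
  /-- The largest `f i` in `LR` is at least the smallest `f j` in `RL`.  If one of the two sets is
  empty, then the other one carries its information past all initial positions. -/
  meet : (∃ i j : Fin n, i.val < p ∧ p ≤ j.val ∧ f j ≤ f i) ∨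
    (p = n ∧ ∃ i : Fin n, ∀ k, pos k ≤ f i) ∨ (p = 0 ∧ ∃ j : Fin n, ∀ k, f j ≤ pos k)
  left_informed : ∀ i k : Fin n, i.val < p → k.val = 0 →
    Knows (trajectory pos (twoMoves b s f)) i k (s i)
  right_informed : ∀ i k : Fin n, p ≤ i.val → k.val + 1 = n →
    Knows (trajectory pos (twoMoves b s f)) i k (s i)

end Convergecast

/-! ## Random access machine over the real numbers

Programs for a real RAM, in structured form, with unit-cost operations.  The memory consists of
arrays of natural numbers (used as indices and counters) and arrays of real numbers.  A program
refers to finitely many arrays by fixed names; the cells of an array are addressed by computed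
indices. -/

namespace RealRAM

/-- The memory: `σ.nat a i` and `σ.real a i` are the `i`-th cells of the arrays with name `a`. -/
structure State where
  nat : ℕ → ℕ → ℕ
  real : ℕ → ℕ → ℝ

/-- Index expressions: constants, memory access, addition and truncated subtraction. -/
inductive NExp where
  | const (k : ℕ)
  | get (a : ℕ) (i : NExp)
  | add (e₁ e₂ : NExp)
  | sub (e₁ e₂ : NExp)

/-- Real expressions: natural number constants, memory access and the four arithmetic operations. -/
inductive RExp where
  | const (k : ℕ)
  | get (a : ℕ) (i : NExp)
  | add (e₁ e₂ : RExp)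
  | sub (e₁ e₂ : RExp)
  | mul (e₁ e₂ : RExp)
  | div (e₁ e₂ : RExp)

/-- Tests: comparisons of index or real expressions and their Boolean combinations. -/
inductive Test where
  | nle (e₁ e₂ : NExp)
  | rle (e₁ e₂ : RExp)
  | not (c : Test)
  | and (c₁ c₂ : Test)

/-- Programs. -/
inductive Prog where
  | skip
  | setN (a : ℕ) (i e : NExp)
  | setR (a : ℕ) (i : NExp) (e : RExp)
  | seq (p₁ p₂ : Prog)
  | cond (c : Test) (p₁ p₂ : Prog)
  | loop (c : Test) (p : Prog)

/-- The value of an index expression. -/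
def NExp.eval (σ : State) : NExp → ℕ
  | const k => k
  | get a i => σ.nat a (i.eval σ)
  | add e₁ e₂ => e₁.eval σ + e₂.eval σ
  | sub e₁ e₂ => e₁.eval σ - e₂.eval σ

/-- The number of operations that the evaluation of an index expression takes. -/
def NExp.cost : NExp → ℕ
  | const _ => 1
  | get _ i => i.cost + 1
  | add e₁ e₂ => e₁.cost + e₂.cost + 1
  | sub e₁ e₂ => e₁.cost + e₂.cost + 1

/-- The value of a real expression.  A division by zero returns zero. -/
noncomputable def RExp.eval (σ : State) : RExp → ℝ
  | const k => (k : ℝ)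
  | get a i => σ.real a (i.eval σ)
  | add e₁ e₂ => e₁.eval σ + e₂.eval σ
  | sub e₁ e₂ => e₁.eval σ - e₂.eval σ
  | mul e₁ e₂ => e₁.eval σ * e₂.eval σ
  | div e₁ e₂ => e₁.eval σ / e₂.eval σ

/-- The number of operations that the evaluation of a real expression takes. -/
def RExp.cost : RExp → ℕ
  | const _ => 1
  | get _ i => i.cost + 1
  | add e₁ e₂ => e₁.cost + e₂.cost + 1
  | sub e₁ e₂ => e₁.cost + e₂.cost + 1
  | mul e₁ e₂ => e₁.cost + e₂.cost + 1
  | div e₁ e₂ => e₁.cost + e₂.cost + 1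

/-- The truth of a test. -/
def Test.holds (σ : State) : Test → Prop
  | nle e₁ e₂ => e₁.eval σ ≤ e₂.eval σ
  | rle e₁ e₂ => e₁.eval σ ≤ e₂.eval σ
  | not c => ¬ c.holds σ
  | and c₁ c₂ => c₁.holds σ ∧ c₂.holds σ

/-- The number of operations that a test takes. -/
def Test.cost : Test → ℕ
  | nle e₁ e₂ => e₁.cost + e₂.cost + 1
  | rle e₁ e₂ => e₁.cost + e₂.cost + 1
  | not c => c.cost + 1
  | and c₁ c₂ => c₁.cost + c₂.cost + 1

/-- Write the number `v` into cell `i` of the array `a` of natural numbers. -/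
def State.setNat (σ : State) (a i v : ℕ) : State :=
  { σ with nat := Function.update σ.nat a (Function.update (σ.nat a) i v) }

/-- Write the number `v` into cell `i` of the array `a` of real numbers. -/
noncomputable def State.setReal (σ : State) (a i : ℕ) (v : ℝ) : State :=
  { σ with real := Function.update σ.real a (Function.update (σ.real a) i v) }

/-- `Exec q σ τ t`: the program `q`, started in the memory `σ`, halts in the memory `τ` after
`t` steps.  The rules are syntax-directed, hence `τ` and `t` are determined by `q` and `σ`. -/
inductive Exec : Prog → State → State → ℕ → Prop
  | skip (σ : State) : Exec .skip σ σ 1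
  | setN (σ : State) (a : ℕ) (i e : NExp) :
      Exec (.setN a i e) σ (σ.setNat a (i.eval σ) (e.eval σ)) (i.cost + e.cost + 1)
  | setR (σ : State) (a : ℕ) (i : NExp) (e : RExp) :
      Exec (.setR a i e) σ (σ.setReal a (i.eval σ) (e.eval σ)) (i.cost + e.cost + 1)
  | seq {q₁ q₂ : Prog} {σ σ' τ : State} {t₁ t₂ : ℕ} :
      Exec q₁ σ σ' t₁ → Exec q₂ σ' τ t₂ → Exec (.seq q₁ q₂) σ τ (t₁ + t₂)
  | condTrue {c : Test} {q₁ q₂ : Prog} {σ τ : State} {t : ℕ} :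
      c.holds σ → Exec q₁ σ τ t → Exec (.cond c q₁ q₂) σ τ (c.cost + t + 1)
  | condFalse {c : Test} {q₁ q₂ : Prog} {σ τ : State} {t : ℕ} :
      ¬ c.holds σ → Exec q₂ σ τ t → Exec (.cond c q₁ q₂) σ τ (c.cost + t + 1)
  | loopTrue {c : Test} {q : Prog} {σ σ' τ : State} {t₁ t₂ : ℕ} :
      c.holds σ → Exec q σ σ' t₁ → Exec (.loop c q) σ' τ t₂ →
        Exec (.loop c q) σ τ (c.cost + t₁ + t₂ + 1)
  | loopFalse {c : Test} {q : Prog} {σ : State} :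
      ¬ c.holds σ → Exec (.loop c q) σ σ (c.cost + 1)

/-- The initial memory for the input `pos`: cell `0` of the array `0` of natural numbers holds the
number `n`, the array `0` of real numbers holds the entries of `pos` in its first `n` cells, and
all other cells hold zero. -/
noncomputable def input {n : ℕ} (pos : Fin n → ℝ) : State where
  nat := fun a i => if a = 0 ∧ i = 0 then n else 0
  real := fun a i => if h : a = 0 ∧ i < n then pos ⟨i, h.2⟩ else 0

/-- The memory holds the output `(P, p, b, s, f)`: cell `0` of the array `1` of real numbers holds
`P`, cell `0` of the array `1` of natural numbers holds `p`, and the arrays `2`, `3`, `4` of real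
numbers hold the entries of `b`, `s`, `f` in their first `n` cells. -/
def State.HasOutput {n : ℕ} (σ : State) (P : ℝ) (p : ℕ) (b s f : Fin n → ℝ) : Prop :=
  σ.real 1 0 = P ∧ σ.nat 1 0 = p ∧
    ∀ i : Fin n, σ.real 2 i = b i ∧ σ.real 3 i = s i ∧ σ.real 4 i = f i

end RealRAM

namespace Convergecast

/-! Put the agents up to `q` on one side and the rest on the other. The left group pushes the
information of agent `0` as far as `reach x P q`; the right group does the same in the reflected
configuration, where agent `q + 1` has index `n - 2 - q`. The two pushes meet when `excess n x P q`
is nonnegative, and this quantity is strictly increasing in `P`. So for `n ≥ 2` the optimal power is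
the `P` at which the maximum of the excess over all splits is zero.

Lower bound (`exists_excess_nonneg`): in any convergecast strategy, the information of the first and
of the last agent meets after travelling along two chains of handovers, which can be taken disjoint.
One more carrier moves the information by at most the map `grow`. Sorting each list of carriers
(`grow_comm`), discarding or swapping carriers until the two lists are separated (`grow_exchange`),
and adding the missing agents never lowers the sum of the two bounds. What remains is a split of
nonnegative excess.

Attainment (`isRegular_and_isConvergecast`): at zero excess both pushes end at the same point.
Starting times spaced by the length of the occupied segment make every handover succeed.

Linear time: `reach x P i` is the minimum over `k ≤ i` of lines in `P` with explicit coefficients,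
and the active line is given by the last `k` whose threshold is at most `P`. A monotone stack yields
all thresholds in amortised linear time. The search then runs through the splits and lowers `P`
while the current split has positive excess. Since `P` never grows, an agent whose threshold is no
longer below `P` is discarded for good. On the left this is a stack, on the right a pointer that
only moves down. -/

/-- The right end of the range of agent `i` when the first agents push the information of agent `0`
to the right with power `P`. -/
noncomputable def reach (x : ℕ → ℝ) (P : ℝ) : ℕ → ℝ
  | 0 => x 0 + P
  | i + 1 => 2 * min (reach x P i) (x (i + 1)) + P - x (i + 1)

/-- The reflected configuration. -/
def mirror (n : ℕ) (x : ℕ → ℝ) : ℕ → ℝ := fun i => -x (n - 1 - i)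

/-- The first `n` entries of `x` are strictly increasing. -/
def Increasing (n : ℕ) (x : ℕ → ℝ) : Prop := ∀ ⦃i j : ℕ⦄, i < j → j < n → x i < x j

theorem Increasing.mirror {n : ℕ} {x : ℕ → ℝ} (hx : Increasing n x) :
    Increasing n (mirror n x) := by
  intro i j hij hj
  have := hx (i := n - 1 - j) (j := n - 1 - i) (by omega) (by omega)
  simp only [Convergecast.mirror]
  linarith

theorem Increasing.le {n : ℕ} {x : ℕ → ℝ} (hx : Increasing n x) {i j : ℕ} (hij : i ≤ j)
    (hj : j < n) : x i ≤ x j := by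
  rcases hij.eq_or_lt with rfl | h
  · exact le_rfl
  · exact (hx h hj).le

/-- By how much the information of the first agent, pushed by the agents up to `q`, and the
information of the last agent, pushed by the others, get past each other. -/
noncomputable def excess (n : ℕ) (x : ℕ → ℝ) (P : ℝ) (q : ℕ) : ℝ :=
  reach x P q + reach (mirror n x) P (n - 2 - q)

theorem reach_le (x : ℕ → ℝ) (P : ℝ) (i : ℕ) : reach x P i ≤ x i + P := by
  cases i with
  | zero => exact le_rfl
  | succ i =>
    have := min_le_right (reach x P i) (x (i + 1))
    simp only [reach]
    linarith

theorem reach_strictMono (x : ℕ → ℝ) (i : ℕ) : StrictMono fun P => reach x P i := by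
  induction i with
  | zero => intro P Q h; simpa [reach] using h
  | succ i ih =>
    intro P Q h
    have := min_le_min_right (x (i + 1)) (ih h).le
    simp only [reach] at this ⊢
    linarith

theorem excess_strictMono (n : ℕ) (x : ℕ → ℝ) (q : ℕ) : StrictMono fun P => excess n x P q :=
  fun _ _ h => add_lt_add (reach_strictMono _ _ h) (reach_strictMono _ _ h)

/-- Each range ends at most `P` beyond the start of its last agent, so the gap between agents `q`
and `q + 1` is at most `2 * P`. -/
theorem pos_of_excess_nonneg {n : ℕ} {x : ℕ → ℝ} (hx : Increasing n x) {q : ℕ} (hq : q + 2 ≤ n)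
    {P : ℝ} (h : 0 ≤ excess n x P q) : 0 < P := by
  have h1 := reach_le x P q
  have h2 := reach_le (mirror n x) P (n - 2 - q)
  have h3 := hx (i := q) (j := q + 1) (by omega) (by omega)
  have h4 : mirror n x (n - 2 - q) = -x (q + 1) := by
    rw [mirror]; congr 2; omega
  rw [excess] at h
  linarith

/-! ### Ranges as minima of lines -/

/-- The weighted sums of the positions that occur in the ranges. -/
noncomputable def weight (x : ℕ → ℝ) : ℕ → ℝ
  | 0 => x 0
  | i + 1 => 2 * weight x i + x (i + 1)

/-- The range of agent `i` if agent `k` waits at its initial position and the agents after `k`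
take over the information where their predecessors stop. -/
noncomputable def line (x : ℕ → ℝ) (k i : ℕ) (P : ℝ) : ℝ :=
  2 ^ (i - k) * (x k + weight x k) - weight x i + (2 ^ (i - k + 1) - 1) * P

theorem line_self (x : ℕ → ℝ) (k : ℕ) (P : ℝ) : line x k k P = x k + P := by
  simp [line]; ring

/-- This is the recursion of `reach` with the minimum always resolved towards the predecessor;
`line` is its closed form. -/
theorem line_succ (x : ℕ → ℝ) {k i : ℕ} (h : k ≤ i) (P : ℝ) :
    line x k (i + 1) P = 2 * line x k i P + P - x (i + 1) := by
  obtain ⟨d, rfl⟩ := Nat.exists_eq_add_of_le h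
  have h1 : k + d + 1 - k = d + 1 := by omega
  have h2 : k + d - k = d := by omega
  simp only [line, h1, h2, weight]
  ring

theorem reach_le_line (x : ℕ → ℝ) (P : ℝ) {k i : ℕ} (h : k ≤ i) : reach x P i ≤ line x k i P := by
  induction i, h using Nat.le_induction with
  | base => rw [line_self]; exact reach_le x P k
  | succ i h ih =>
    rw [line_succ x h, reach]
    have := min_le_left (reach x P i) (x (i + 1))
    linarith

theorem reach_eq_line (x : ℕ → ℝ) (P : ℝ) {k i : ℕ} (h : k ≤ i)
    (hk : ∀ j, j + 1 = k → x k ≤ reach x P j)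
    (hi : ∀ j, k ≤ j → j < i → reach x P j ≤ x (j + 1)) : reach x P i = line x k i P := by
  induction i, h using Nat.le_induction with
  | base =>
    rw [line_self]
    cases k with
    | zero => rfl
    | succ k => rw [reach, min_eq_right (hk k rfl)]; ring
  | succ i h ih =>
    rw [line_succ x h, reach, min_eq_left (hi i h (by omega)), ih fun j h1 h2 => hi j h1 (by omega)]

/-- `th (k + 1)` is the power with which the agents up to `k` just reach agent `k + 1`. -/
structure IsThreshold (n : ℕ) (x th : ℕ → ℝ) : Prop where
  zero : th 0 = 0
  succ : ∀ k, k + 1 < n → reach x (th (k + 1)) k = x (k + 1)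

/-- Comparing `P` with the thresholds decides every minimum in `reach` from agent `k` on: agent `k`
is reached at its start, the later ones are not overtaken. -/
theorem IsThreshold.reach_eq_line {n : ℕ} {x th : ℕ → ℝ} (h : IsThreshold n x th) {P : ℝ}
    {k i : ℕ} (hki : k ≤ i) (hi : i < n) (hk : th k ≤ P) (hj : ∀ j, k < j → j ≤ i → P ≤ th j) :
    reach x P i = line x k i P := by
  refine Convergecast.reach_eq_line x P hki (fun j hjk => ?_) fun j h1 h2 => ?_
  · subst hjk
    rw [← h.succ j (by omega)]
    exact (reach_strictMono x j).monotone hk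
  · rw [← h.succ j (by omega)]
    exact (reach_strictMono x j).monotone (hj (j + 1) (by omega) (by omega))

/-- At power `r` the range is at most `x (i + 1)`, hence at most the range at `th j`. By strict
monotonicity `r ≤ th j` for all later `j`, so the line of `k` is the active one at `r`. -/
theorem IsThreshold.extend {i : ℕ} {x th : ℕ → ℝ} (h : IsThreshold (i + 1) x th)
    {k : ℕ} (hk : k ≤ i) {r : ℝ} (hr : th k ≤ r) (hroot : line x k i r = x (i + 1))
    (hdead : ∀ j, k < j → j ≤ i → x (i + 1) ≤ reach x (th j) i) :
    reach x r i = x (i + 1) ∧ ∀ j, k < j → j ≤ i → r ≤ th j := by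
  have hle : reach x r i ≤ x (i + 1) := hroot ▸ reach_le_line x r hk
  have h1 : ∀ j, k < j → j ≤ i → r ≤ th j := fun j h1 h2 =>
    (reach_strictMono x i).le_iff_le.1 (hle.trans (hdead j h1 h2))
  exact ⟨(h.reach_eq_line hk (by omega) hr h1).trans hroot, h1⟩

/-! ### Bounds on trajectories -/

theorem distance_nonneg (x : ℝ) (L : List Leg) : 0 ≤ distance x L := by
  induction L generalizing x with
  | nil => exact le_rfl
  | cons m L ih => exact add_nonneg (abs_nonneg _) (ih _)

theorem abs_walk_sub {x y d : ℝ} (hd : 0 ≤ d) : |x - walk x y d| = d := by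
  unfold walk
  split_ifs
  · rw [sub_add_cancel_left, abs_neg, abs_of_nonneg hd]
  · rw [sub_sub_cancel, abs_of_nonneg hd]

theorem abs_walk_sub_target {x y d : ℝ} (hd : d ≤ |y - x|) :
    |walk x y d - y| = |y - x| - d := by
  unfold walk
  split_ifs with h
  · rw [abs_of_nonneg (sub_nonneg.2 h)] at hd ⊢
    rw [abs_of_nonpos (by linarith)]; ring
  · rw [abs_of_neg (a := y - x) (by linarith)] at hd ⊢
    rw [abs_of_nonneg (by linarith)]; ring

theorem abs_walk_sub_walk {x y d e : ℝ} (h : d ≤ e) : |walk x y d - walk x y e| = e - d := by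
  unfold walk
  split_ifs
  · rw [abs_of_nonpos (by linarith)]; ring
  · rw [abs_of_nonneg (by linarith)]; ring

theorem abs_location_le (x : ℝ) (L : List Leg) (t : ℝ) :
    |x - location x L t| ≤ distance x L := by
  induction L generalizing x with
  | nil => simp [location, distance]
  | cons m L ih =>
    have h0 := distance_nonneg m.target L
    simp only [location, distance]
    split_ifs with h
    · rw [abs_walk_sub (le_max_left _ _)]
      have : max 0 (t - m.start) ≤ |m.target - x| := max_le (abs_nonneg _) (by linarith)
      linarith
    · have h1 := abs_sub_le x m.target (location m.target L t)
      rw [abs_sub_comm x m.target] at h1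
      linarith [ih m.target]

/-- The way to the location at time `t` and from there to a later location is not longer than the
distance travelled. -/
theorem abs_location_add_le (x : ℝ) (L : List Leg) {t u : ℝ} (htu : t ≤ u) :
    |x - location x L t| + |location x L t - location x L u| ≤ distance x L := by
  induction L generalizing x with
  | nil => simp [location, distance]
  | cons m L ih =>
    have h0 := distance_nonneg m.target L
    simp only [location, distance]
    split_ifs with h1 h2 h2
    · have h3 : max 0 (u - m.start) ≤ |m.target - x| := max_le (abs_nonneg _) (by linarith)
      rw [abs_walk_sub (le_max_left _ _), abs_walk_sub_walk (max_le_max_left 0 (by linarith))]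
      linarith
    · have h3 : max 0 (t - m.start) ≤ |m.target - x| := max_le (abs_nonneg _) (by linarith)
      have h4 := abs_sub_le (walk x m.target (max 0 (t - m.start))) m.target
        (location m.target L u)
      rw [abs_walk_sub_target h3] at h4
      rw [abs_walk_sub (le_max_left _ _)]
      linarith [abs_location_le m.target L u]
    · linarith
    · have h3 := abs_sub_le x m.target (location m.target L t)
      rw [abs_sub_comm x m.target] at h3
      linarith [ih m.target]

theorem location_zero (ℓ x : ℝ) (L : List Leg) {T : ℝ} (hT : 0 ≤ T) (h : Feasible ℓ T x L) :
    location x L 0 = x := by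
  induction L generalizing x T with
  | nil => rfl
  | cons m L ih =>
    obtain ⟨h1, -, h3⟩ := h
    have h4 := abs_nonneg (m.target - x)
    simp only [location]
    split_ifs with h5
    · rw [max_eq_left (by linarith)]; simp [walk]
    -- A leg that is over at time `0` has length zero.
    · have h6 : |m.target - x| = 0 := by linarith
      have h7 : m.target = x := by linarith [abs_eq_zero.1 h6]
      rw [ih m.target (by linarith) h3, h7]

/-! ### Chains of agents that hand over information -/

/-- The information of agent `j` has been handed over along the list, which starts with the agent
that got it last, at the given time. -/
inductive Chain {n : ℕ} (x : Fin n → ℝ → ℝ) (j : Fin n) : List (Fin n) → ℝ → Prop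
  | base : Chain x j [j] 0
  | step {i k : Fin n} {l : List (Fin n)} {s t : ℝ} :
      Chain x j (k :: l) s → s ≤ t → x i t = x k t → Chain x j (i :: k :: l) t

theorem Chain.suffix {n : ℕ} {x : Fin n → ℝ → ℝ} {j : Fin n} {L : List (Fin n)} {s : ℝ}
    (h : Chain x j L s) {i : Fin n} {l : List (Fin n)} (hl : i :: l <:+ L) :
    ∃ u ≤ s, Chain x j (i :: l) u := by
  induction h with
  | base =>
    obtain ⟨rfl, rfl⟩ : i = j ∧ l = [] := by
      rcases List.suffix_cons_iff.1 hl with h | h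
      · simpa using h
      · simp at h
    exact ⟨0, le_rfl, .base⟩
  | step hc hst he ih =>
    rcases List.suffix_cons_iff.1 hl with h | h
    · exact ⟨_, le_rfl, h ▸ .step hc hst he⟩
    · obtain ⟨u, hu, hc'⟩ := ih h
      exact ⟨u, hu.trans hst, hc'⟩

theorem Chain.exists_suffix {n : ℕ} {x : Fin n → ℝ → ℝ} {j : Fin n} {L : List (Fin n)} {s : ℝ}
    (h : Chain x j L s) {i : Fin n} (hi : i ∈ L) :
    ∃ l u, i :: l <:+ L ∧ u ≤ s ∧ Chain x j (i :: l) u := by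
  obtain ⟨v, l, rfl⟩ := List.append_of_mem hi
  obtain ⟨u, hu, hc⟩ := h.suffix (List.suffix_append v (i :: l))
  exact ⟨l, u, List.suffix_append _ _, hu, hc⟩

theorem Chain.neg {n : ℕ} {x : Fin n → ℝ → ℝ} {j : Fin n} {L : List (Fin n)} {s : ℝ}
    (h : Chain x j L s) : Chain (fun i t => -x i t) j L s := by
  induction h with
  | base => exact .base
  | step _ hst he ih => exact .step ih hst (by rw [he])

theorem Knows.exists_chain {n : ℕ} {x : Fin n → ℝ → ℝ} {i j : Fin n} {t : ℝ}
    (h : Knows x i j t) : ∃ l s, s ≤ t ∧ Chain x j (i :: l) s ∧ (i :: l).Nodup := by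
  induction h with
  | own i => exact ⟨[], 0, le_rfl, .base, by simp⟩
  | keep _ hst ih =>
    obtain ⟨l, u, hu, hc⟩ := ih
    exact ⟨l, u, hu.trans hst, hc⟩
  | @meet i k j t _ he ih =>
    obtain ⟨l, u, hu, hc, hn⟩ := ih
    -- If `i` already occurs, it held the information earlier, and the loop is cut off.
    by_cases hi : i ∈ k :: l
    · obtain ⟨l', v, hs, hv, hc'⟩ := hc.exists_suffix hi
      exact ⟨l', v, hv.trans hu, hc', hn.sublist hs.sublist⟩
    · exact ⟨k :: l, t, le_rfl, .step hc hu he, List.nodup_cons.2 ⟨hi, hn⟩⟩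

/-! ### Bounds on how far a list of agents can carry information -/

/-- The position up to which information at `m` can be carried to the right with the help of an
agent from `x` with power `P`. -/
noncomputable def grow (P x m : ℝ) : ℝ := max m (2 * min m x + P - x)

theorem le_grow (P x m : ℝ) : m ≤ grow P x m := le_max_left _ _

theorem grow_mono (P x : ℝ) : Monotone (grow P x) := by
  intro m m' h
  have := min_le_min_right x h
  exact max_le_max h (by linarith)

/-- Of two helpers, the one that starts further left should help first. -/
theorem grow_comm {P x y : ℝ} (hP : 0 ≤ P) (h : x ≤ y) (m : ℝ) :
    grow P x (grow P y m) ≤ grow P y (grow P x m) := by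
  unfold grow
  rcases le_total m x with h1 | h1 <;> rcases le_total m y with h2 | h2 <;>
    simp only [min_eq_left, min_eq_right, h1, h2]  <;>
    simp only [max_def, min_def] <;> split_ifs <;> linarith

/-- The agent at `y` carries to the right and the one at `x < y` to the left. By `h2` and `h3`
neither can be dropped, so both maxima in `grow` are attained by the second term. The claim that
exchanging their roles does no harm is then a linear inequality in each case of the minima. -/
theorem grow_exchange {P x y m u : ℝ} (h : x < y)
    (h1 : 0 ≤ grow P y m + grow P (-x) u) (h2 : m + grow P (-x) u < 0)
    (h3 : grow P y m + u < 0) : 0 ≤ grow P x m + grow P (-y) u := by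
  have h4 : grow P y m = 2 * min m y + P - y := by
    refine max_eq_right (le_of_not_gt fun h => ?_)
    rw [grow, max_eq_left h.le] at h1; linarith
  have h5 : grow P (-x) u = 2 * min u (-x) + P + x := by
    have h5 : grow P (-x) u = max u (2 * min u (-x) + P + x) := by rw [grow, sub_neg_eq_add]
    rw [h5]
    refine max_eq_right (le_of_not_gt fun h => ?_)
    rw [h5, max_eq_left h.le] at h1; linarith
  have h6 : 2 * min m x + P - x ≤ grow P x m := le_max_right _ _
  have h7 : 2 * min u (-y) + P + y ≤ grow P (-y) u := by
    rw [grow, sub_neg_eq_add]; exact le_max_right _ _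
  have h8 := le_grow P y m
  have h9 := le_grow P (-x) u
  rw [h4, h5] at h1
  rw [h5] at h2 h9
  rw [h4] at h3 h8
  rcases min_cases m y with ⟨a1, b1⟩ | ⟨a1, b1⟩ <;>
    rcases min_cases m x with ⟨a2, b2⟩ | ⟨a2, b2⟩ <;>
    rcases min_cases u (-x) with ⟨a3, b3⟩ | ⟨a3, b3⟩ <;>
    rcases min_cases u (-y) with ⟨a4, b4⟩ | ⟨a4, b4⟩ <;>
    rw [a1] at h1 h3 h8 <;> rw [a3] at h1 h2 h9 <;> rw [a2] at h6 <;> rw [a4] at h7 <;> linarith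

/-- The position up to which information at `m` can be carried by the agents in a list, the last
one first. -/
noncomputable def carry {ι : Type*} (P : ℝ) (y : ι → ℝ) (m : ℝ) (l : List ι) : ℝ :=
  l.foldr (fun i => grow P (y i)) m

theorem carry_cons {ι : Type*} (P : ℝ) (y : ι → ℝ) (m : ℝ) (i : ι) (l : List ι) :
    carry P y m (i :: l) = grow P (y i) (carry P y m l) := rfl

/-- An agent that picks up the information at `y` has spent at least the distance from its start `p`
to `y`. It gets at most to `y + P - |p - y|`, which is `2 * min y p + P - p`. -/
theorem Chain.le_carry {n : ℕ} {x : Fin n → ℝ → ℝ} {pos : Fin n → ℝ} {P : ℝ}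
    (hx : ∀ i t u, t ≤ u → |pos i - x i t| + |x i t - x i u| ≤ P) {j : Fin n}
    {L : List (Fin n)} {s : ℝ} (h : Chain x j L s) {i : Fin n} {l : List (Fin n)}
    (hL : L = i :: l) {t : ℝ} (ht : s ≤ t) : x i t ≤ carry P pos (pos j) L := by
  induction h generalizing i l t with
  | base =>
    obtain ⟨rfl, rfl⟩ : j = i ∧ [] = l := by simpa using hL
    have h1 := hx j t t le_rfl
    have h2 := neg_abs_le (pos j - x j t)
    rw [sub_self, abs_zero] at h1
    refine le_trans ?_ (le_max_right _ _)
    simp only [List.foldr_nil, min_self]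
    linarith
  | @step i' k l' s u hc hsu he ih =>
    obtain ⟨rfl, rfl⟩ : i' = i ∧ k :: l' = l := by simpa using hL
    have h1 := hx i' u t ht
    have h2 := ih rfl hsu
    rw [← he] at h2
    refine le_trans ?_ ((le_max_right _ _).trans (grow_mono P (pos i') h2))
    have h3 := neg_abs_le (x i' u - x i' t)
    rcases min_cases (x i' u) (pos i') with ⟨a, b⟩ | ⟨a, b⟩
    · have := le_abs_self (pos i' - x i' u); rw [a]; linarith
    · have := neg_abs_le (pos i' - x i' u); rw [a]; linarith

/-! ### Sorting the carriers -/

theorem carry_orderedInsert {ι : Type*} {P : ℝ} (hP : 0 ≤ P) {y : ι → ℝ} (r : ι → ι → Prop)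
    [DecidableRel r] (hr : ∀ a b, ¬ r a b → y a ≤ y b) (m : ℝ) (i : ι) (l : List ι) :
    carry P y m (i :: l) ≤ carry P y m (l.orderedInsert r i) := by
  induction l with
  | nil => exact le_rfl
  | cons j l ih =>
    rw [List.orderedInsert]
    split_ifs with h
    · exact le_rfl
    · exact (grow_comm hP (hr _ _ h) _).trans (grow_mono _ _ ih)

theorem carry_insertionSort {ι : Type*} {P : ℝ} (hP : 0 ≤ P) {y : ι → ℝ} (r : ι → ι → Prop)
    [DecidableRel r] (hr : ∀ a b, ¬ r a b → y a ≤ y b) (m : ℝ) (l : List ι) :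
    carry P y m l ≤ carry P y m (l.insertionSort r) := by
  induction l with
  | nil => exact le_rfl
  | cons i l ih =>
    exact (grow_mono _ _ ih).trans (carry_orderedInsert hP r hr m i _)

/-- The position up to which information at `z 0` can be carried by the first agents. -/
noncomputable def carryAll (P : ℝ) (z : ℕ → ℝ) : ℕ → ℝ
  | 0 => z 0
  | k + 1 => grow P (z k) (carryAll P z k)

/-- Inserting the missing agents cannot hurt, because `m ≤ grow P x m`. -/
theorem carry_le_carryAll {ι : Type*} {P : ℝ} {y : ι → ℝ} {z : ℕ → ℝ} {ρ : ι → ℕ} {p : ℕ}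
    {l : List ι} (hy : ∀ i ∈ l, y i = z (ρ i)) (hs : l.Pairwise fun a b => ρ b < ρ a)
    (hl : ∀ i ∈ l, ρ i < p) : carry P y (z 0) l ≤ carryAll P z p := by
  induction p generalizing l with
  | zero =>
    cases l with
    | nil => exact le_rfl
    | cons i l => exact absurd (hl i (by simp)) (by omega)
  | succ p ih =>
    cases l with
    | nil => exact (ih (l := []) (by simp) (by simp) (by simp)).trans (le_grow _ _ _)
    | cons i l =>
      rw [List.pairwise_cons] at hs
      have hi := hl i (by simp)
      rcases Nat.lt_succ_iff_lt_or_eq.1 hi with h | h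
      · refine (ih hy (List.pairwise_cons.2 hs) fun j hj => ?_).trans (le_grow _ _ _)
        rcases List.mem_cons.1 hj with rfl | hj
        · exact h
        · exact (hs.1 j hj).trans h
      · rw [carry_cons, carryAll, hy i (by simp), h]
        exact grow_mono _ _ (ih (fun j hj => hy j (by simp [hj])) hs.2
          fun j hj => h ▸ hs.1 j hj)

/-- The head of a list acts last. After sorting, the heads are the largest `a` of `A` and the
smallest `b` of `B`, so only the case `b < a` needs work: drop one of the two if possible, otherwise
exchange them. The induction is on the total length and, within it, on the sum of the indices in
`A`. -/
theorem exists_separated {n : ℕ} {pos : Fin n → ℝ} (hpos : StrictMono pos) {P : ℝ} (hP : 0 ≤ P)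
    (m u : ℝ) {A B : List (Fin n)} (hA : A.Nodup) (hB : B.Nodup) (hAB : A.Disjoint B)
    (h : 0 ≤ carry P pos m A + carry P (fun i => -pos i) u B) :
    ∃ A' B' : List (Fin n), A'.Pairwise (fun a b => b < a) ∧ B'.Pairwise (fun a b => a < b) ∧
      (∀ a ∈ A', ∀ b ∈ B', a < b) ∧
      0 ≤ carry P pos m A' + carry P (fun i => -pos i) u B' := by
  obtain ⟨N, hN⟩ : ∃ N, N = A.length + B.length := ⟨_, rfl⟩
  obtain ⟨M, hM⟩ : ∃ M, M = (A.map Fin.val).sum := ⟨_, rfl⟩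
  induction N using Nat.strong_induction_on generalizing A B M with
  | _ N ihN =>
  induction M using Nat.strong_induction_on generalizing A B with
  | _ M ihM =>
  have pA := List.perm_insertionSort (fun a b : Fin n => b ≤ a) A
  have pB := List.perm_insertionSort (fun a b : Fin n => a ≤ b) B
  have cA := carry_insertionSort (ι := Fin n) (y := pos) hP (fun a b => b ≤ a)
    (fun a b hab => hpos.monotone (not_le.1 hab).le) m A
  have cB := carry_insertionSort (ι := Fin n) (y := fun i => -pos i) hP (fun a b => a ≤ b)
    (fun a b hab => neg_le_neg (hpos.monotone (not_le.1 hab).le)) u B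
  have sA : (A.insertionSort (fun a b : Fin n => b ≤ a)).Pairwise (fun a b => b < a) := by
    have h1 := List.pairwise_insertionSort (fun a b : Fin n => b ≤ a) A
    have h2 : (A.insertionSort (fun a b : Fin n => b ≤ a)).Nodup := pA.nodup_iff.2 hA
    exact (h1.and h2).imp fun h => lt_of_le_of_ne h.1 (Ne.symm h.2)
  have sB : (B.insertionSort (fun a b : Fin n => a ≤ b)).Pairwise (fun a b => a < b) := by
    have h1 := List.pairwise_insertionSort (fun a b : Fin n => a ≤ b) B
    have h2 : (B.insertionSort (fun a b : Fin n => a ≤ b)).Nodup := pB.nodup_iff.2 hB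
    exact (h1.and h2).imp fun h => lt_of_le_of_ne h.1 h.2
  generalize A.insertionSort (fun a b : Fin n => b ≤ a) = A₁ at *
  generalize B.insertionSort (fun a b : Fin n => a ≤ b) = B₁ at *
  have hd : A₁.Disjoint B₁ := fun a h1 h2 => hAB (pA.mem_iff.1 h1) (pB.mem_iff.1 h2)
  have hA₁ := pA.nodup_iff.2 hA
  have hB₁ := pB.nodup_iff.2 hB
  replace h := h.trans (add_le_add cA cB)
  rw [← pA.length_eq, ← pB.length_eq] at hN
  rw [← (pA.map Fin.val).sum_eq] at hM
  clear pA pB cA cB hA hB hAB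
  rcases A₁ with _ | ⟨a, A₁⟩
  · exact ⟨[], B₁, sA, sB, by simp, h⟩
  rcases B₁ with _ | ⟨b, B₁⟩
  · exact ⟨a :: A₁, [], sA, sB, by simp, h⟩
  rcases lt_trichotomy a b with hab | rfl | hab
  · refine ⟨a :: A₁, b :: B₁, sA, sB, fun a' ha' b' hb' => ?_, h⟩
    have h1 : a' ≤ a := by
      rcases List.mem_cons.1 ha' with rfl | h'
      · exact le_rfl
      · exact ((List.pairwise_cons.1 sA).1 _ h').le
    have h2 : b ≤ b' := by
      rcases List.mem_cons.1 hb' with rfl | h'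
      · exact le_rfl
      · exact ((List.pairwise_cons.1 sB).1 _ h').le
    exact h1.trans_lt (hab.trans_le h2)
  · exact absurd (List.mem_cons_self) (hd (List.mem_cons_self))
  rw [List.nodup_cons] at hA₁ hB₁
  by_cases h2 : 0 ≤ carry P pos m A₁ + carry P (fun i => -pos i) u (b :: B₁)
  · exact ihN _ (by simp [hN]) hA₁.2 (List.nodup_cons.2 hB₁)
      (List.disjoint_of_disjoint_cons_left hd) h2 rfl _ rfl
  by_cases h3 : 0 ≤ carry P pos m (a :: A₁) + carry P (fun i => -pos i) u B₁
  · exact ihN _ (by simp [hN]) (List.nodup_cons.2 hA₁) hB₁.2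
      (List.disjoint_of_disjoint_cons_right hd) h3 rfl _ rfl
  -- Neither head can be dropped. Replacing `a` by the smaller `b` in `A` lowers the index sum; the
  -- next round sorts again.
  have h4 := grow_exchange (hpos hab) h (not_le.1 h2) (not_le.1 h3)
  rw [List.disjoint_cons_left, List.disjoint_cons_right] at hd
  refine ihM _ ?_ (A := b :: A₁) (B := a :: B₁) ?_ ?_ ?_ h4 (by simpa using hN) rfl
  · simp only [hM, List.map_cons, List.sum_cons]
    exact Nat.add_lt_add_right hab _
  · exact List.nodup_cons.2 ⟨hd.2.1, hA₁.2⟩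
  · exact List.nodup_cons.2 ⟨fun h' => hd.1 (by simp [h']), hB₁.2⟩
  · rw [List.disjoint_cons_left, List.disjoint_cons_right]
    exact ⟨by simpa using ⟨hab.ne, hB₁.1⟩, hA₁.1, hd.2.2⟩

/-! ### From separated carriers to a split of nonnegative excess -/

theorem carryAll_succ_le {n : ℕ} {z : ℕ → ℝ} (hz : Increasing n z) {P : ℝ} (hP : 0 ≤ P) {p : ℕ}
    (hp : p < n) : carryAll P z (p + 1) ≤ z p + P := by
  induction p with
  | zero => simp only [carryAll, grow, min_self]; exact max_le (by linarith) (by linarith)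
  | succ p ih =>
    have h1 := hz (Nat.lt_succ_self p) hp
    have h2 := min_le_right (carryAll P z (p + 1)) (z (p + 1))
    rw [carryAll]
    exact max_le (by linarith [ih (by omega)]) (by linarith)

/-- The recursions of `carryAll` and `reach` differ only in the outer maximum of `grow`. It matters
only when the next agent cannot walk to the information, and then no later agent can either. -/
theorem carryAll_succ {n : ℕ} {z : ℕ → ℝ} (hz : Increasing n z) {P : ℝ} (hP : 0 ≤ P) {p : ℕ}
    (hp : p < n) :
    carryAll P z (p + 1) = reach z P p ∨ carryAll P z (p + 1) + P < z p := by
  induction p with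
  | zero => left; simp only [carryAll, grow, min_self, reach]; rw [max_eq_right] <;> linarith
  | succ p ih =>
    have h1 := hz (Nat.lt_succ_self p) hp
    have h0 := carryAll_succ_le hz hP (p := p) (by omega)
    rw [carryAll]
    generalize carryAll P z (p + 1) = m at *
    by_cases h : m + P < z (p + 1)
    · right
      rw [grow, min_eq_left (by linarith), max_eq_left (by linarith)]
      exact h
    · left
      rcases ih (by omega) with h' | h'
      · subst h'
        rw [grow, reach, max_eq_right]
        rcases min_cases (reach z P p) (z (p + 1)) with ⟨a, b⟩ | ⟨a, b⟩ <;> rw [a] <;> linarith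
      · linarith

theorem exists_excess_nonneg_of_carryAll {n : ℕ} (hn : 2 ≤ n) {x : ℕ → ℝ} (hx : Increasing n x)
    {P : ℝ} (hP : 0 ≤ P) {p : ℕ} (hp : p ≤ n)
    (h : 0 ≤ carryAll P x p + carryAll P (mirror n x) (n - p)) :
    ∃ q, q + 2 ≤ n ∧ 0 ≤ excess n x P q := by
  -- If one side is stuck more than `P` short of its last agent, then the other side, ending at most
  -- `P` beyond the start of its own last agent, cannot close the gap.
  have key : ∀ q, q + 2 ≤ n →
      0 ≤ carryAll P x (q + 1) + carryAll P (mirror n x) (n - 2 - q + 1) →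
      0 ≤ excess n x P q := by
    intro q hq h
    have h1 := hx (Nat.lt_succ_self q) (by omega)
    have h2 : mirror n x (n - 2 - q) = -x (q + 1) := by rw [mirror]; congr 2; omega
    have h3 := carryAll_succ_le hx hP (p := q) (by omega)
    have h4 := carryAll_succ_le hx.mirror hP (p := n - 2 - q) (by omega)
    rcases carryAll_succ hx hP (p := q) (by omega) with a | a
    · rcases carryAll_succ hx.mirror hP (p := n - 2 - q) (by omega) with b | b
      · rwa [excess, ← a, ← b]
      · simp only [Nat.succ_eq_add_one] at h1; linarith
    · simp only [Nat.succ_eq_add_one] at h1; linarith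
  -- For the two splits with an empty side: if the outermost agent, at `X`, can help to bring the
  -- information to `X`, it can also walk towards the information and meet it.
  have last : ∀ X m : ℝ, 0 ≤ grow P X m - X → 0 ≤ m + grow P (-X) (-X) := by
    intro X m hm
    have h1 : -X + P ≤ grow P (-X) (-X) := by
      rw [grow, min_self]; exact le_trans (by linarith) (le_max_right _ _)
    have h2 : grow P X m ≤ max m (2 * m + P - X) := by
      have := min_le_left m X
      exact max_le_max le_rfl (by linarith)
    rcases le_total m (2 * m + P - X) with a | a
    · rw [max_eq_right a] at h2; linarith
    · rw [max_eq_left a] at h2; linarith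
  obtain ⟨m, rfl⟩ : ∃ m, n = m + 2 := ⟨n - 2, by omega⟩
  rcases Nat.eq_zero_or_pos p with rfl | hp0
  · refine ⟨0, by omega, key 0 (by omega) ?_⟩
    have h1 : mirror (m + 2) x (m + 1) = -x 0 := by simp [mirror]
    have h2 : m + 2 - 2 = m := by omega
    simp only [tsub_zero, carryAll, h1, h2] at h ⊢
    have := last (-x 0) (carryAll P (mirror (m + 2) x) m |> grow P (mirror (m + 2) x m))
      (by linarith)
    rw [neg_neg] at this
    linarith
  rcases hp.eq_or_lt with rfl | hp1
  · refine ⟨m, by omega, key m (by omega) ?_⟩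
    have h1 : mirror (m + 2) x 0 = -x (m + 1) := by simp [mirror]
    have h2 : m + 2 - 2 - m = 0 := by omega
    simp only [tsub_self, carryAll, h1, h2] at h ⊢
    exact last (x (m + 1)) _ (by linarith)
  · refine ⟨p - 1, by omega, key (p - 1) (by omega) ?_⟩
    have h1 : p - 1 + 1 = p := by omega
    have h2 : m + 2 - 2 - (p - 1) + 1 = m + 2 - p := by omega
    rwa [h1, h2]

/-- The carriers of two pieces of information that come together. -/
theorem exists_disjoint_chains {n : ℕ} {x : Fin n → ℝ → ℝ} {i j k : Fin n} {t : ℝ}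
    (hj : Knows x i j t) (hk : Knows x i k t) :
    ∃ (z : Fin n) (l l' : List (Fin n)) (s s' : ℝ), Chain x j (z :: l) s ∧
      Chain x k (z :: l') s' ∧ (z :: l).Nodup ∧ (z :: l').Nodup ∧ l.Disjoint l' := by
  classical
  -- Choose the pair of chains of least total length. An agent in both tails would itself be the end
  -- of a shorter pair.
  let C : ℕ → Prop := fun N => ∃ (z : Fin n) (l l' : List (Fin n)) (s s' : ℝ),
    Chain x j (z :: l) s ∧ Chain x k (z :: l') s' ∧ (z :: l).Nodup ∧ (z :: l').Nodup ∧
      l.length + l'.length = N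
  have hC : ∃ N, C N := by
    obtain ⟨l, s, -, h1, h2⟩ := hj.exists_chain
    obtain ⟨l', s', -, h1', h2'⟩ := hk.exists_chain
    exact ⟨_, i, l, l', s, s', h1, h1', h2, h2', rfl⟩
  obtain ⟨z, l, l', s, s', h1, h1', h2, h2', hN⟩ := Nat.find_spec hC
  refine ⟨z, l, l', s, s', h1, h1', h2, h2', fun a ha ha' => ?_⟩
  have aux : ∀ {j : Fin n} {l : List (Fin n)} {s : ℝ}, Chain x j (z :: l) s → (z :: l).Nodup →
      a ∈ l → ∃ v u, Chain x j (a :: v) u ∧ (a :: v).Nodup ∧ v.length < l.length := by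
    intro j l s hc hn hal
    obtain ⟨v, u, hs, -, hc'⟩ := hc.exists_suffix (List.mem_cons_of_mem z hal)
    refine ⟨v, u, hc', hn.sublist hs.sublist, ?_⟩
    rcases List.suffix_cons_iff.1 hs with h | h
    · obtain ⟨rfl, rfl⟩ := List.cons_eq_cons.1 h
      exact absurd hal (List.nodup_cons.1 hn).1
    · simpa using h.length_le
  obtain ⟨v, u, c1, c2, c3⟩ := aux h1 h2 ha
  obtain ⟨v', u', c1', c2', c3'⟩ := aux h1' h2' ha'
  exact Nat.find_min hC (m := v.length + v'.length) (by omega)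
    ⟨a, v, v', u, u', c1, c1', c2, c2', rfl⟩

/-- A chain that does not have to include the agent which gets the information last. -/
theorem Chain.le_carry_tail {n : ℕ} {x : Fin n → ℝ → ℝ} {pos : Fin n → ℝ} {P : ℝ}
    (hx : ∀ i t u, t ≤ u → |pos i - x i t| + |x i t - x i u| ≤ P) (h0 : ∀ i, x i 0 = pos i)
    {j i : Fin n} {l : List (Fin n)} {s : ℝ} (h : Chain x j (i :: l) s) :
    x i s ≤ carry P pos (pos j) l := by
  cases h with
  | base => exact (h0 j).le
  | step hc hst he => rw [he]; exact hc.le_carry hx rfl hst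

theorem exists_excess_nonneg {n : ℕ} (hn : 2 ≤ n) {ℓ : ℝ} {pos : Fin n → ℝ} (hpos : StrictMono pos)
    {x : ℕ → ℝ} (hx : ∀ i : Fin n, x i = pos i) {P : ℝ} {S : Strategy n}
    (hS : IsConvergecast ℓ pos P S) : ∃ q, q + 2 ≤ n ∧ 0 ≤ excess n x P q := by
  have hP : 0 ≤ P := (distance_nonneg _ _).trans (hS.power ⟨0, by omega⟩)
  have hinc : Increasing n x := fun i j hij hj => by
    have := hpos (show (⟨i, hij.trans hj⟩ : Fin n) < ⟨j, hj⟩ from hij)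
    rwa [← hx, ← hx] at this
  set X := trajectory pos S
  have hX : ∀ i t u, t ≤ u → |pos i - X i t| + |X i t - X i u| ≤ P := fun i t u htu =>
    (abs_location_add_le (pos i) (S i) htu).trans (hS.power i)
  have hX' : ∀ i t u, t ≤ u → |-pos i - -X i t| + |-X i t - -X i u| ≤ P := fun i t u htu => by
    rw [neg_sub_neg, neg_sub_neg, abs_sub_comm, abs_sub_comm (X i u)]
    exact hX i t u htu
  have hX0 : ∀ i, X i 0 = pos i := fun i => location_zero ℓ _ _ le_rfl (hS.feasible i)
  obtain ⟨i, t, hK⟩ := hS.collect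
  obtain ⟨z, l, l', s, s', h1, h1', h2, h2', hd⟩ :=
    exists_disjoint_chains (hK ⟨0, by omega⟩) (hK ⟨n - 1, by omega⟩)
  have h3 : ∃ A B : List (Fin n), A.Nodup ∧ B.Nodup ∧ A.Disjoint B ∧
      0 ≤ carry P pos (pos ⟨0, by omega⟩) A +
        carry P (fun i => -pos i) (-pos ⟨n - 1, by omega⟩) B := by
    rw [List.nodup_cons] at h2 h2'
    -- The common agent `z` is counted as a carrier only of the piece it gets first. At the later of
    -- the two times its position is bounded from one side by that full chain and from the other by
    -- the tail of the second chain.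
    rcases le_total s s' with h | h
    · refine ⟨z :: l, l', List.nodup_cons.2 h2, h2'.2, ?_, ?_⟩
      · rw [List.disjoint_cons_left]; exact ⟨h2'.1, hd⟩
      · have a := h1.le_carry hX rfl h
        have b := h1'.neg.le_carry_tail (pos := fun i => -pos i) hX' (fun i => by rw [hX0])
        linarith
    · refine ⟨l, z :: l', h2.2, List.nodup_cons.2 h2', ?_, ?_⟩
      · rw [List.disjoint_cons_right]; exact ⟨h2.1, hd⟩
      · have a := h1.le_carry_tail hX hX0
        have b := h1'.neg.le_carry (pos := fun i => -pos i) hX' rfl h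
        linarith
  obtain ⟨A, B, hA, hB, hAB, h4⟩ := h3
  obtain ⟨A', B', sA, sB, hs, h5⟩ := exists_separated hpos hP _ _ hA hB hAB h4
  obtain ⟨p, hp, hp1, hp2⟩ : ∃ p ≤ n, (∀ a ∈ A', a.val < p) ∧ ∀ b ∈ B', p ≤ b.val := by
    rcases B' with _ | ⟨b, B'⟩
    · exact ⟨n, le_rfl, fun a _ => a.2, by simp⟩
    · refine ⟨b, b.2.le, fun a ha => hs a ha b (by simp), fun c hc => ?_⟩
      rcases List.mem_cons.1 hc with rfl | h
      · exact le_rfl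
      · exact ((List.pairwise_cons.1 sB).1 c h).le
  refine exists_excess_nonneg_of_carryAll hn hinc hP hp (h5.trans (add_le_add ?_ ?_))
  · rw [← hx ⟨0, by omega⟩]
    exact carry_le_carryAll (ρ := Fin.val) (fun i _ => (hx i).symm) sA hp1
  · have h6 : -pos ⟨n - 1, by omega⟩ = mirror n x 0 := by rw [mirror, ← hx]; simp
    rw [h6]
    refine carry_le_carryAll (ρ := fun i => n - 1 - i.val) (fun i _ => ?_)
      (sB.imp fun {a b} h => ?_) fun b hb => ?_
    · have := i.2
      rw [← hx, mirror]; congr 2; omega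
    · have := b.2
      have h' : a.val < b.val := h
      omega
    · have := hp2 b hb
      have := b.2
      omega

/-! ### Regular strategies -/

/-- The point to which an agent goes first when the first agents push the information of agent `0`
to the right with power `P`. -/
noncomputable def base (x : ℕ → ℝ) (P : ℝ) : ℕ → ℝ
  | 0 => x 0
  | i + 1 => min (reach x P i) (x (i + 1))

theorem reach_eq_base (x : ℕ → ℝ) (P : ℝ) (i : ℕ) : reach x P i = 2 * base x P i + P - x i := by
  cases i <;> simp only [reach, base]; ring

theorem base_le (x : ℕ → ℝ) (P : ℝ) (i : ℕ) : base x P i ≤ x i := by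
  cases i
  · exact le_rfl
  · exact min_le_right _ _

theorem location_eq_base {x b s f t : ℝ} (h1 : |b - x| ≤ t) (h2 : t ≤ s) :
    location x [⟨0, b⟩, ⟨s, f⟩] t = b := by
  have := abs_nonneg (f - b)
  simp only [location, zero_add, not_lt.2 h1, if_false]
  split_ifs with h
  · rw [max_eq_left (by linarith)]; simp [walk]
  · have h3 : |f - b| = 0 := by linarith
    linarith [abs_eq_zero.1 h3]

theorem location_eq_end {x b s f t : ℝ} (h1 : |b - x| ≤ t) (h2 : s + |f - b| ≤ t) :
    location x [⟨0, b⟩, ⟨s, f⟩] t = f := by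
  simp only [location, zero_add, not_lt.2 h1, not_lt.2 h2, if_false]

theorem location_eq_right {x b s f y : ℝ} (h1 : |b - x| ≤ s) (h2 : b ≤ y) (h3 : y ≤ f) :
    location x [⟨0, b⟩, ⟨s, f⟩] (s + (y - b)) = y := by
  rcases h3.eq_or_lt with rfl | h3
  · refine location_eq_end (by linarith) ?_
    rw [abs_of_nonneg (by linarith)]
  · have h4 : ¬ s + (y - b) < |b - x| := by linarith
    have h5 : s + (y - b) < s + |f - b| := by rw [abs_of_nonneg (by linarith)]; linarith
    simp only [location, zero_add, h4, h5, if_false, if_true]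
    rw [max_eq_right (by linarith), walk, if_pos (by linarith)]
    ring

theorem location_eq_left {x b s f y : ℝ} (h1 : |b - x| ≤ s) (h2 : f ≤ y) (h3 : y ≤ b) :
    location x [⟨0, b⟩, ⟨s, f⟩] (s + (b - y)) = y := by
  rcases h2.eq_or_lt with rfl | h2
  · refine location_eq_end (by linarith) ?_
    rw [abs_of_nonpos (by linarith)]
    linarith
  · have h4 : ¬ s + (b - y) < |b - x| := by linarith
    have h5 : s + (b - y) < s + |f - b| := by rw [abs_of_nonpos (by linarith)]; linarith
    simp only [location, zero_add, h4, h5, if_false, if_true]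
    rw [max_eq_right (by linarith), walk, if_neg (by linarith)]
    ring

theorem knows_of_relay {n : ℕ} {X : Fin n → ℝ → ℝ} {κ : ℕ → Fin n} {s : ℕ → ℝ} {m : ℕ}
    (h0 : 0 ≤ s 0)
    (h : ∀ k < m, ∃ t, s k ≤ t ∧ t ≤ s (k + 1) ∧ X (κ (k + 1)) t = X (κ k) t) {k : ℕ}
    (hk : k ≤ m) {j : ℕ} (hj : j ≤ k) : Knows X (κ k) (κ j) (s k) := by
  have hs : ∀ k ≤ m, 0 ≤ s k := by
    intro k
    induction k with
    | zero => exact fun _ => h0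
    | succ k ih =>
      intro hk
      obtain ⟨t, h1, h2, -⟩ := h k hk
      exact ((ih (by omega)).trans h1).trans h2
  induction k with
  | zero => obtain rfl : j = 0 := by omega
            exact .keep (.own _) h0
  | succ k ih =>
    rcases hj.eq_or_lt with rfl | hj
    · exact .keep (.own _) (hs _ hk)
    · obtain ⟨t, h1, h2, h3⟩ := h k hk
      exact .keep (.meet (.keep (ih (by omega) (by omega)) h1) h3) h2

/-- If the last agent of a push strategy gets far enough, then no agent fails to reach its
predecessor. -/
theorem le_reach_add {n : ℕ} {z : ℕ → ℝ} (hz : Increasing n z) {P : ℝ} {m : ℕ} (hm : m < n)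
    (h : z m ≤ reach z P m + P) {k : ℕ} (hk : k < m) : z (k + 1) ≤ reach z P k + P := by
  -- If agent `k + 1` is more than `P` away from the information, its formal range ends before that
  -- of its predecessor; so the gap exceeds `P` for all later agents, including `m`.
  by_contra! hlt
  have : ∀ j, k + 1 ≤ j → j ≤ m → reach z P j + P < z j := by
    intro j hj
    induction j, hj using Nat.le_induction with
    | base =>
      intro _
      have := min_le_left (reach z P k) (z (k + 1))
      rw [reach]; linarith
    | succ j hj ih =>
      intro hjm
      have h1 := ih (by omega)
      have h2 := min_le_left (reach z P j) (z (j + 1))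
      have h3 := hz (Nat.lt_succ_self j) (by omega : j + 1 < n)
      simp only [Nat.succ_eq_add_one] at h3
      rw [reach]; linarith
  linarith [this m hk le_rfl]

/-- The agents up to `m` can push the information of agent `0` without leaving the segment that
ends at `e`. -/
structure CanPush (z : ℕ → ℝ) (P e : ℝ) (m : ℕ) : Prop where
  base_mono : ∀ k < m, base z P k ≤ base z P (k + 1)
  le_base : ∀ k ≤ m, z 0 ≤ base z P k
  base_le_reach : ∀ k ≤ m, base z P k ≤ reach z P k
  reach_le : ∀ k ≤ m, reach z P k ≤ e
  le_end : ∀ k ≤ m, z k ≤ e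

/-- By `le_reach_add` each agent can get to the end of its predecessor's range within its power, so
its own range does not end earlier. -/
theorem reach_mono {n : ℕ} {z : ℕ → ℝ} (hz : Increasing n z) {P : ℝ} {m : ℕ} (hm : m < n)
    (h : z m ≤ reach z P m + P) {k l : ℕ} (hkl : k ≤ l) (hl : l ≤ m) :
    reach z P k ≤ reach z P l := by
  induction l, hkl using Nat.le_induction with
  | base => exact le_rfl
  | succ l hkl ih =>
    refine (ih (by omega)).trans ?_
    have h1 := le_reach_add hz hm h (k := l) (by omega)
    have h2 := reach_le z P l
    have h3 := hz (Nat.lt_succ_self l) (by omega : l + 1 < n)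
    simp only [Nat.succ_eq_add_one] at h3
    rw [reach]
    rcases min_cases (reach z P l) (z (l + 1)) with ⟨a, b⟩ | ⟨a, b⟩ <;> rw [a] <;> linarith

theorem canPush {n : ℕ} {z : ℕ → ℝ} (hz : Increasing n z) {P : ℝ} (hP : 0 ≤ P) {m : ℕ}
    (hm : m < n) (h : z m ≤ reach z P m + P) (he : reach z P m ≤ z (n - 1)) :
    CanPush z P (z (n - 1)) m := by
  have h1 : ∀ k ≤ m, base z P k ≤ reach z P k := by
    intro k hk
    cases k with
    | zero => simp only [base, reach]; linarith
    | succ k =>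
      have h1 := le_reach_add hz hm h (k := k) (by omega)
      rw [reach, base]
      rcases min_cases (reach z P k) (z (k + 1)) with ⟨a, b⟩ | ⟨a, b⟩ <;> rw [a] <;> linarith
  have h2 : ∀ k < m, base z P k ≤ base z P (k + 1) := fun k hk =>
    le_min (h1 k hk.le) ((base_le z P k).trans (hz (Nat.lt_succ_self k) (by omega)).le)
  refine ⟨h2, fun k => ?_, h1, fun k hk => (reach_mono hz hm h hk le_rfl).trans he,
    fun k hk => hz.le (by omega) (by omega)⟩
  induction k with
  | zero => exact fun _ => le_rfl
  | succ k ih => exact fun hk => (ih (by omega)).trans (h2 k hk)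

/-- One side of a regular strategy, where `ε` is the direction of the movement. -/
theorem CanPush.knows {n : ℕ} {pos b s f : Fin n → ℝ} {z : ℕ → ℝ} {P e : ℝ} {m : ℕ}
    (h : CanPush z P e m) {ε : ℝ} (hε : ε = 1 ∨ ε = -1) {κ : ℕ → Fin n}
    (hpos : ∀ k ≤ m, pos (κ k) = ε * z k) (hb : ∀ k ≤ m, b (κ k) = ε * base z P k)
    (hf : ∀ k ≤ m, f (κ k) = ε * reach z P k) (hs : ∀ k ≤ m, s (κ k) = (k + 1) * (e - z 0))
    {k j : ℕ} (hk : k ≤ m) (hj : j ≤ k) :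
    Knows (trajectory pos (twoMoves b s f)) (κ k) (κ j) (s (κ k)) := by
  have hD : 0 ≤ e - z 0 := sub_nonneg.2 (h.le_end 0 (by omega))
  refine knows_of_relay (κ := κ) (s := fun k => s (κ k)) (m := m) ?_ ?_ hk hj
  · simp only [hs 0 (by omega)]; push_cast; linarith
  intro k hk
  have hks : (0 : ℝ) ≤ k * (e - z 0) := mul_nonneg (Nat.cast_nonneg k) hD
  have a1 := h.base_mono k hk
  have a2 := h.le_base k hk.le
  have a3 := h.le_base (k + 1) hk
  have a4 := h.reach_le k hk.le
  have a5 : base z P (k + 1) ≤ reach z P k := min_le_left _ _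
  have a6 := h.le_end (k + 1) hk
  have a7 := base_le z P (k + 1)
  have a8 := base_le z P k
  have a9 := h.le_end k hk.le
  -- The time at which agent `k` passes the waiting point of agent `k + 1`. All distances involved
  -- are at most `e - z 0`, the spacing of the starting times, so agent `k + 1` has arrived there
  -- and has not yet left.
  refine ⟨s (κ k) + (base z P (k + 1) - base z P k), by linarith, ?_, ?_⟩
  · simp only [hs k hk.le, hs (k + 1) hk]; push_cast; linarith
  · have c1 : |b (κ (k + 1)) - pos (κ (k + 1))| = z (k + 1) - base z P (k + 1) := by
      rw [hb _ hk, hpos _ hk, ← mul_sub, abs_mul, abs_sub_comm, abs_of_nonneg (sub_nonneg.2 a7)]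
      rcases hε with rfl | rfl <;> simp
    have c2 : |b (κ k) - pos (κ k)| = z k - base z P k := by
      rw [hb _ hk.le, hpos _ hk.le, ← mul_sub, abs_mul, abs_sub_comm,
        abs_of_nonneg (sub_nonneg.2 a8)]
      rcases hε with rfl | rfl <;> simp
    have d1 := hs k hk.le
    have d2 := hs (k + 1) hk
    push_cast at d2
    change location _ [⟨0, b (κ (k + 1))⟩, ⟨s (κ (k + 1)), f (κ (k + 1))⟩] _ =
      location (pos (κ k)) [⟨0, b (κ k)⟩, ⟨s (κ k), f (κ k)⟩] _
    rw [location_eq_base (by rw [c1]; linarith) (by linarith)]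
    rcases hε with rfl | rfl
    · have := location_eq_right (x := pos (κ k)) (b := b (κ k)) (s := s (κ k)) (f := f (κ k))
        (y := b (κ (k + 1))) (by rw [c2]; linarith)
        (by rw [hb _ hk, hb _ hk.le]; linarith) (by rw [hb _ hk, hf _ hk.le]; linarith)
      rw [hb _ hk, hb _ hk.le, one_mul, one_mul] at this
      rw [hb _ hk, hb _ hk.le, one_mul, one_mul]
      exact this.symm
    · have := location_eq_left (x := pos (κ k)) (b := b (κ k)) (s := s (κ k)) (f := f (κ k))
        (y := b (κ (k + 1))) (by rw [c2]; linarith)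
        (by rw [hb _ hk, hf _ hk.le]; linarith) (by rw [hb _ hk, hb _ hk.le]; linarith)
      rw [hb _ hk, hb _ hk.le] at this
      rw [hb _ hk, hb _ hk.le]
      rw [show base z P (k + 1) - base z P k = -1 * base z P k - -1 * base z P (k + 1) by ring]
      exact this.symm

/-- At zero excess each range ends at the point where the opposite one ends. As the opposite range
ends at most `P` beyond its agent's start, no agent fails to take over. As it covers at least the
first step of length `P` from the far end, the push stays between the outermost agents. -/
theorem exists_canPush {n : ℕ} {x : ℕ → ℝ} (hx : Increasing n x) {P : ℝ} {q : ℕ} (hq : q + 2 ≤ n)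
    (h : excess n x P q = 0) :
    CanPush x P (x (n - 1)) q ∧ CanPush (mirror n x) P (mirror n x (n - 1)) (n - 2 - q) := by
  have hP := (pos_of_excess_nonneg hx hq h.ge).le
  have h0 := hx (Nat.lt_succ_self q) (by omega : q + 1 < n)
  have h1 : mirror n x (n - 2 - q) = -x (q + 1) := by rw [mirror]; congr 2; omega
  have h2 := reach_le x P q
  have h3 := reach_le (mirror n x) P (n - 2 - q)
  have h4 : mirror n x (n - 1) = -x 0 := by simp [mirror]
  have h5 : mirror n x 0 = -x (n - 1) := by simp [mirror]
  rw [excess] at h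
  simp only [Nat.succ_eq_add_one] at h0
  have a1 : x q ≤ reach x P q + P := by linarith
  have a2 : mirror n x (n - 2 - q) ≤ reach (mirror n x) P (n - 2 - q) + P := by linarith
  have b1 := reach_mono hx (by omega) a1 (Nat.zero_le q) le_rfl
  have b2 := reach_mono hx.mirror (by omega) a2 (Nat.zero_le _) le_rfl
  rw [reach] at b1 b2
  exact ⟨canPush hx hP (by omega) a1 (by linarith),
    canPush hx.mirror hP (by omega) a2 (by linarith)⟩

theorem isRegular_and_isConvergecast {n : ℕ} {ℓ : ℝ} {pos : Fin n → ℝ} (hpos : StrictMono pos)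
    (hℓ : ∀ i, pos i ∈ Set.Icc 0 ℓ) {x : ℕ → ℝ} (hx : ∀ i : Fin n, x i = pos i) {P : ℝ} {q : ℕ}
    (hq : q + 2 ≤ n) (h : excess n x P q = 0) {b s f : Fin n → ℝ}
    (hb : ∀ i : Fin n, b i =
      if i.val ≤ q then base x P i else -base (mirror n x) P (n - 1 - i))
    (hf : ∀ i : Fin n, f i =
      if i.val ≤ q then reach x P i else -reach (mirror n x) P (n - 1 - i))
    (hs : ∀ i : Fin n, s i = ((if i.val ≤ q then i.val else n - 1 - i : ℕ) + 1) *
      (x (n - 1) - x 0)) :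
    IsRegular pos P (q + 1) b s f ∧ IsConvergecast ℓ pos P (twoMoves b s f) := by
  have hinc : Increasing n x := fun i j hij hj => by
    have := hpos (show (⟨i, hij.trans hj⟩ : Fin n) < ⟨j, hj⟩ from hij)
    rwa [← hx, ← hx] at this
  have hP := (pos_of_excess_nonneg hinc hq h.ge).le
  obtain ⟨hL, hR⟩ := exists_canPush hinc hq h
  have m0 : mirror n x 0 = -x (n - 1) := by simp [mirror]
  have m1 : mirror n x (n - 1) = -x 0 := by simp [mirror]
  have hD : 0 ≤ x (n - 1) - x 0 := sub_nonneg.2 (hinc.le (by omega) (by omega))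
  have posR : ∀ i : Fin n, pos i = -mirror n x (n - 1 - i) := fun i => by
    have := i.2
    rw [mirror, neg_neg, ← hx]; congr 1; omega
  let κ : ℕ → Fin n := fun k => if hk : k < n then ⟨k, hk⟩ else ⟨0, by omega⟩
  let ν : ℕ → Fin n := fun k => ⟨n - 1 - k, by omega⟩
  have hκ : ∀ k < n, (κ k).val = k := fun k hk => by simp [κ, hk]
  have hν : ∀ k < n, n - 1 - (ν k).val = k := fun k hk => by simp only [ν]; omega
  have κval : ∀ i : Fin n, κ i = i := fun i => by simp [κ]
  have νval : ∀ i : Fin n, ν (n - 1 - i) = i := fun i => by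
    have := i.2
    ext; simp only [ν]; omega
  have knowsL : ∀ i j : Fin n, i.val ≤ q → j ≤ i →
      Knows (trajectory pos (twoMoves b s f)) i j (s i) := by
    intro i j hi hj
    have := hL.knows (pos := pos) (b := b) (s := s) (f := f) (ε := 1) (.inl rfl) (κ := κ)
      (fun k hk => by rw [one_mul, ← hx, hκ k (by omega)])
      (fun k hk => by rw [one_mul, hb, hκ k (by omega), if_pos hk])
      (fun k hk => by rw [one_mul, hf, hκ k (by omega), if_pos hk])
      (fun k hk => by rw [hs, hκ k (by omega), if_pos hk]) hi hj
    rwa [κval, κval] at this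
  have knowsR : ∀ i j : Fin n, q < i.val → i ≤ j →
      Knows (trajectory pos (twoMoves b s f)) i j (s i) := by
    intro i j hi hj
    have h1 : ∀ k ≤ n - 2 - q, ¬ (ν k).val ≤ q := fun k hk => by simp only [ν]; omega
    have := hR.knows (pos := pos) (b := b) (s := s) (f := f) (ε := -1) (.inr rfl) (κ := ν)
      (fun k hk => by rw [neg_one_mul, posR, hν k (by omega)])
      (fun k hk => by rw [neg_one_mul, hb, if_neg (h1 k hk), hν k (by omega)])
      (fun k hk => by rw [neg_one_mul, hf, if_neg (h1 k hk), hν k (by omega)])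
      (fun k hk => by
        rw [hs, if_neg (h1 k hk), hν k (by omega), m0, m1, neg_sub_neg])
      (k := n - 1 - i) (j := n - 1 - j) (by omega) (by have : i.val ≤ j.val := hj; omega)
    rwa [νval, νval] at this
  -- Zero excess means that the two groups finish at the same point, where they exchange everything.
  have hmeet : f ⟨q, by omega⟩ = f ⟨q + 1, by omega⟩ := by
    rw [hf, hf]
    simp only [le_refl, if_true, Nat.succ_le_iff, lt_irrefl, if_false]
    rw [excess] at h
    rw [show n - 1 - (q + 1) = n - 2 - q by omega]
    linarith
  have side : ∀ i : Fin n, |b i - pos i| + |f i - b i| = P ∧ |b i - pos i| ≤ x (n - 1) - x 0 ∧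
      b i ∈ Set.Icc (x 0) (x (n - 1)) ∧ f i ∈ Set.Icc (x 0) (x (n - 1)) := by
    intro i
    by_cases hi : i.val ≤ q
    · have c1 := base_le x P i
      have c2 := hL.base_le_reach i hi
      have c3 := hL.le_base i hi
      have c4 := hL.reach_le i hi
      have c5 := hL.le_end i hi
      have c6 := reach_eq_base x P i
      rw [hb, hf, ← hx, if_pos hi, if_pos hi, abs_of_nonpos (by linarith),
        abs_of_nonneg (by linarith)]
      refine ⟨by linarith, by linarith, ⟨by linarith, by linarith⟩, by linarith, by linarith⟩
    · have hi' : n - 1 - i.val ≤ n - 2 - q := by omega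
      have c1 := base_le (mirror n x) P (n - 1 - i)
      have c2 := hR.base_le_reach _ hi'
      have c3 := hR.le_base _ hi'
      have c4 := hR.reach_le _ hi'
      have c5 := hR.le_end _ hi'
      have c6 := reach_eq_base (mirror n x) P (n - 1 - i)
      rw [m0] at c3
      rw [m1] at c4 c5
      rw [hb, hf, posR, if_neg hi, if_neg hi, abs_of_nonneg (by linarith),
        abs_of_nonpos (by linarith)]
      refine ⟨by linarith, by linarith, ⟨by linarith, by linarith⟩, by linarith, by linarith⟩
  have hsD : ∀ i, x (n - 1) - x 0 ≤ s i ∧ s i ≤ n * (x (n - 1) - x 0) := by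
    intro i
    rw [hs]
    have h1 : (if i.val ≤ q then i.val else n - 1 - i : ℕ) + 1 ≤ n := by split_ifs <;> omega
    generalize (if i.val ≤ q then i.val else n - 1 - i : ℕ) = c at *
    have h2 : (c : ℝ) + 1 ≤ n := by exact_mod_cast h1
    have h3 : (0 : ℝ) ≤ c := Nat.cast_nonneg c
    constructor <;> nlinarith
  have h0ℓ : 0 ≤ x 0 ∧ x (n - 1) ≤ ℓ := by
    have h1 := (hℓ ⟨0, by omega⟩).1
    have h2 := (hℓ ⟨n - 1, by omega⟩).2
    rw [← hx] at h1 h2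
    exact ⟨h1, h2⟩
  refine ⟨⟨by omega, ?_, ?_, ?_, ?_, ?_, ?_, ?_, ?_, ?_⟩, ⟨?_, ?_, ?_⟩⟩
  · intro i hi h0
    rw [hb, if_pos (by omega), ← hx, h0, base]
  · intro i j hij hj
    rw [hb, hf, if_pos (by omega), if_pos (by omega), ← hx, ← hij, base]
  · intro i hi
    rw [hb, hf, if_pos (by omega), if_pos (by omega), ← hx]
    exact ⟨reach_eq_base _ _ _, hL.base_le_reach _ (by omega)⟩
  · intro i hi h0
    rw [hb, if_neg (by omega), posR, show n - 1 - i.val = 0 by omega, base]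
  · intro i j hij hi
    rw [hb, hf, if_neg (by omega), if_neg (by omega), posR,
      show n - 1 - i.val = n - 1 - j.val + 1 by omega, base, max_neg_neg]
  · intro i hi
    rw [hb, hf, if_neg (by omega), if_neg (by omega), posR]
    have h1 := hR.base_le_reach (n - 1 - i) (by omega)
    have h2 := reach_eq_base (mirror n x) P (n - 1 - i)
    constructor <;> linarith
  · exact .inl ⟨⟨q, by omega⟩, ⟨q + 1, by omega⟩, by simp, by simp, hmeet.ge⟩
  · intro i k hi hk
    exact knowsL i k (by omega) (by rw [Fin.le_def]; omega)
  · intro i k hi hk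
    exact knowsR i k (by omega) (by rw [Fin.le_def]; omega)
  · intro i
    obtain ⟨-, h1, h2, h3⟩ := side i
    refine ⟨le_rfl, ⟨h0ℓ.1.trans h2.1, h2.2.trans h0ℓ.2⟩, ?_, ⟨h0ℓ.1.trans h3.1, h3.2.trans h0ℓ.2⟩,
      trivial⟩
    simp only [zero_add]
    exact h1.trans (hsD i).1
  · intro i
    simp only [twoMoves, distance, add_zero]
    exact (side i).1.le
  · have hT : ∀ i, s i ≤ n * (x (n - 1) - x 0) + P := fun i => by linarith [(hsD i).2]
    have hend : ∀ i, trajectory pos (twoMoves b s f) i (n * (x (n - 1) - x 0) + P) = f i := by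
      intro i
      obtain ⟨h1, h2, -, -⟩ := side i
      have h3 := abs_nonneg (f i - b i)
      have h4 := abs_nonneg (b i - pos i)
      have h5 := hsD i
      exact location_eq_end (by linarith) (by linarith)
    refine ⟨⟨q, by omega⟩, n * (x (n - 1) - x 0) + P, fun j => ?_⟩
    by_cases hj : j.val ≤ q
    · exact .keep (knowsL ⟨q, by omega⟩ j le_rfl hj) (hT _)
    · refine .meet (k := ⟨q + 1, by omega⟩) (.keep (knowsR ⟨q + 1, by omega⟩ j (by simp) ?_) (hT _))
        (by rw [hend, hend, hmeet])
      rw [Fin.le_def]; simp only; omega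

/-- A feasible `Q` has nonnegative excess at some split; there `P` has nonpositive excess, so `P ≤
Q` by strict monotonicity. -/
theorem isOptimalPower_of_excess {n : ℕ} (hn : 2 ≤ n) {ℓ : ℝ} {pos : Fin n → ℝ}
    (hpos : StrictMono pos) {x : ℕ → ℝ} (hx : ∀ i : Fin n, x i = pos i) {P : ℝ} {S : Strategy n}
    (hS : IsConvergecast ℓ pos P S) (h : ∀ q, q + 2 ≤ n → excess n x P q ≤ 0) :
    IsOptimalPower ℓ pos P := by
  refine ⟨⟨S, hS⟩, fun Q ⟨S', hS'⟩ => ?_⟩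
  obtain ⟨q, hq, hQ⟩ := exists_excess_nonneg hn hpos hx hS'
  exact (excess_strictMono n x q).le_iff_le.1 ((h q hq).trans hQ)

theorem single_agent {ℓ : ℝ} {pos : Fin 1 → ℝ} (hℓ : ∀ i, pos i ∈ Set.Icc 0 ℓ)
    {b s f : Fin 1 → ℝ} (hb : b 0 = pos 0) (hf : f 0 = pos 0) (hs : s 0 = 0) :
    IsOptimalPower ℓ pos 0 ∧ IsRegular pos 0 1 b s f ∧ IsConvergecast ℓ pos 0 (twoMoves b s f) := by
  have hall : ∀ i : Fin 1, i = 0 := fun i => Subsingleton.elim _ _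
  have hS : IsConvergecast ℓ pos 0 (twoMoves b s f) := by
    refine ⟨fun i => ?_, fun i => ?_, 0, 0, fun j => by rw [hall j]; exact .own _⟩
    · rw [hall i]
      refine ⟨le_rfl, by rw [hb]; exact hℓ 0, ?_, by rw [hf]; exact hℓ 0, trivial⟩
      simp [hs, hb]
    · rw [hall i]
      simp [twoMoves, distance, hb, hf]
  refine ⟨⟨⟨_, hS⟩, fun Q ⟨S, h⟩ => (distance_nonneg _ _).trans (h.power 0)⟩, ?_, hS⟩
  refine ⟨le_rfl, fun i _ _ => by rw [hall i, hb], fun i j _ _ => by omega,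
    fun i _ => by rw [hall i, hb, hf]; constructor <;> linarith, fun i _ _ => by omega,
    fun i j _ _ => by omega, fun i _ => by omega,
    .inr (.inl ⟨rfl, 0, fun k => by rw [hall k, hf]⟩), fun i k _ _ => ?_, fun i k _ _ => by omega⟩
  rw [hall i, hall k, hs]
  exact .own _

end Convergecast

namespace RealRAM

/-! ### Reasoning about programs -/

/-- Started in the memory `σ`, the program halts, and its final memory and its running time
satisfy `Q`. -/
def Halts (q : Prog) (σ : State) (Q : State → ℕ → Prop) : Prop := ∃ τ t, Exec q σ τ t ∧ Q τ t

theorem Halts.imp {q : Prog} {σ : State} {Q R : State → ℕ → Prop} (h : Halts q σ Q)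
    (hQR : ∀ τ t, Q τ t → R τ t) : Halts q σ R :=
  let ⟨τ, t, h1, h2⟩ := h
  ⟨τ, t, h1, hQR τ t h2⟩

theorem halts_skip {σ : State} {Q : State → ℕ → Prop} : Halts .skip σ Q ↔ Q σ 1 :=
  ⟨fun ⟨_, _, h, hQ⟩ => by cases h; exact hQ, fun h => ⟨_, _, .skip σ, h⟩⟩

theorem halts_setN {σ : State} {Q : State → ℕ → Prop} {a : ℕ} {i e : NExp} :
    Halts (.setN a i e) σ Q ↔ Q (σ.setNat a (i.eval σ) (e.eval σ)) (i.cost + e.cost + 1) :=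
  ⟨fun ⟨_, _, h, hQ⟩ => by cases h; exact hQ, fun h => ⟨_, _, .setN σ a i e, h⟩⟩

theorem halts_setR {σ : State} {Q : State → ℕ → Prop} {a : ℕ} {i : NExp} {e : RExp} :
    Halts (.setR a i e) σ Q ↔ Q (σ.setReal a (i.eval σ) (e.eval σ)) (i.cost + e.cost + 1) :=
  ⟨fun ⟨_, _, h, hQ⟩ => by cases h; exact hQ, fun h => ⟨_, _, .setR σ a i e, h⟩⟩

theorem halts_seq {σ : State} {Q : State → ℕ → Prop} {q₁ q₂ : Prog} :
    Halts (.seq q₁ q₂) σ Q ↔ Halts q₁ σ fun σ' t₁ => Halts q₂ σ' fun τ t₂ => Q τ (t₁ + t₂) := by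
  constructor
  · rintro ⟨τ, t, h, hQ⟩
    cases h with
    | seq h1 h2 => exact ⟨_, _, h1, _, _, h2, hQ⟩
  · rintro ⟨σ', t₁, h1, τ, t₂, h2, hQ⟩
    exact ⟨_, _, .seq h1 h2, hQ⟩

theorem halts_cond {σ : State} {Q : State → ℕ → Prop} {c : Test} {q₁ q₂ : Prog} :
    Halts (.cond c q₁ q₂) σ Q ↔ (c.holds σ → Halts q₁ σ fun τ t => Q τ (c.cost + t + 1)) ∧
      (¬ c.holds σ → Halts q₂ σ fun τ t => Q τ (c.cost + t + 1)) := by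
  constructor
  · rintro ⟨τ, t, h, hQ⟩
    cases h with
    | condTrue hc h => exact ⟨fun _ => ⟨_, _, h, hQ⟩, fun hn => absurd hc hn⟩
    | condFalse hc h => exact ⟨fun hn => absurd hn hc, fun _ => ⟨_, _, h, hQ⟩⟩
  · rintro ⟨h1, h2⟩
    by_cases hc : c.holds σ
    · obtain ⟨τ, t, h, hQ⟩ := h1 hc
      exact ⟨_, _, .condTrue hc h, hQ⟩
    · obtain ⟨τ, t, h, hQ⟩ := h2 hc
      exact ⟨_, _, .condFalse hc h, hQ⟩

/-- A loop whose body preserves the invariant `I` and pays for its running time out of the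
potential `Φ`. -/
theorem halts_loop {σ : State} {c : Test} {q : Prog} (I : State → Prop) (Φ : State → ℕ) (hI : I σ)
    (h : ∀ σ, I σ → c.holds σ → Halts q σ fun τ t => I τ ∧ c.cost + t + 1 + Φ τ ≤ Φ σ) :
    Halts (.loop c q) σ fun τ t => I τ ∧ ¬ c.holds τ ∧ t + Φ τ ≤ Φ σ + c.cost + 1 := by
  obtain ⟨N, hN⟩ : ∃ N, N = Φ σ := ⟨_, rfl⟩
  induction N using Nat.strong_induction_on generalizing σ with
  | _ N ih =>
  by_cases hc : c.holds σ
  · obtain ⟨σ', t, h1, h2, h3⟩ := h σ hI hc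
    obtain ⟨τ, u, h4, h5, h6, h7⟩ := ih (Φ σ') (by omega) h2 rfl
    exact ⟨τ, _, .loopTrue hc h1 h4, h5, h6, by omega⟩
  · exact ⟨σ, _, .loopFalse hc, hI, hc, by omega⟩

theorem setNat_nat_self (σ : State) (a i v : ℕ) :
    (σ.setNat a i v).nat a = Function.update (σ.nat a) i v := by
  simp [State.setNat]

theorem setNat_nat_of_ne (σ : State) {a b : ℕ} (h : b ≠ a) (i v : ℕ) :
    (σ.setNat a i v).nat b = σ.nat b := by
  simp [State.setNat, h]

theorem setNat_real (σ : State) (a i v : ℕ) : (σ.setNat a i v).real = σ.real := rfl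

theorem setReal_nat (σ : State) (a i : ℕ) (v : ℝ) : (σ.setReal a i v).nat = σ.nat := rfl

theorem setReal_real_self (σ : State) (a i : ℕ) (v : ℝ) :
    (σ.setReal a i v).real a = Function.update (σ.real a) i v := by
  simp [State.setReal]

theorem setReal_real_of_ne (σ : State) {a b : ℕ} (h : b ≠ a) (i : ℕ) (v : ℝ) :
    (σ.setReal a i v).real b = σ.real b := by
  simp [State.setReal, h]

end RealRAM

namespace Convergecast

/-! ### The stack for the thresholds -/

/-- The power for which the line of agent `k` ends at agent `i + 1`. -/
noncomputable def root (z : ℕ → ℝ) (k i : ℕ) : ℝ :=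
  (z (i + 1) + weight z i - 2 ^ (i - k) * (z k + weight z k)) / (2 ^ (i + 1 - k) - 1)

theorem one_le_two_pow_succ_sub_one (k : ℕ) : (1 : ℝ) ≤ 2 ^ (k + 1) - 1 := by
  have : (1 : ℝ) ≤ 2 ^ k := one_le_pow₀ (by norm_num)
  rw [pow_succ]; linarith

theorem line_root (z : ℕ → ℝ) {k i : ℕ} (h : k ≤ i) : line z k i (root z k i) = z (i + 1) := by
  have h1 := one_le_two_pow_succ_sub_one (i - k)
  rw [line, root, show i + 1 - k = i - k + 1 by omega, mul_div_cancel₀ _ (by linarith)]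
  ring

theorem line_strictMono (z : ℕ → ℝ) (k i : ℕ) : StrictMono (line z k i) := by
  intro P Q h
  have h1 := one_le_two_pow_succ_sub_one (i - k)
  have := mul_lt_mul_of_pos_left h (by linarith : (0 : ℝ) < 2 ^ (i - k + 1) - 1)
  simp only [line]
  linarith

theorem line_zero_le {n : ℕ} {z : ℕ → ℝ} (hz : Increasing n z) {P : ℝ} (hP : P ≤ 0) {i : ℕ}
    (hi : i < n) : line z 0 i P ≤ z i := by
  induction i with
  | zero => rw [line_self]; linarith
  | succ i ih =>
    have h1 := ih (by omega)
    have h2 := (hz (Nat.lt_succ_self i) hi).le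
    simp only [Nat.succ_eq_add_one] at h2
    rw [line_succ z (Nat.zero_le i)]
    linarith

/-- With `th 0 = 0` this makes the test at the bottom of the stack superfluous, so agent `0` is
never removed. -/
theorem root_zero_nonneg {n : ℕ} {z : ℕ → ℝ} (hz : Increasing n z) {i : ℕ} (hi : i + 1 < n) :
    0 ≤ root z 0 i := by
  by_contra! h
  have h1 := line_zero_le hz h.le (i := i) (by omega)
  have h2 := hz (Nat.lt_succ_self i) hi
  rw [line_root z (Nat.zero_le i)] at h1
  simp only [Nat.succ_eq_add_one] at h2
  linarith

/-- The stack holds the agents up to `i` whose lines contribute to the range of agent `i`. -/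
structure ThresholdStack (th : ℕ → ℝ) (i : ℕ) (st : ℕ → ℕ) (v : ℕ) : Prop where
  zero : st 0 = 0
  top : st v = i
  mono : ∀ a b, a ≤ b → b ≤ v → st a ≤ st b
  -- Consequently thresholds do not decrease along the stack, and at `P = th (st a)` the line of `st
  -- a` is active.
  later : ∀ a ≤ v, ∀ j, st a < j → j ≤ i → th (st a) ≤ th j
  -- An agent missing from the stack is superseded by the next entry: whenever its threshold is met,
  -- so is that of this later agent.
  between : ∀ a < v, ∀ j, st a < j → j < st (a + 1) → th (st (a + 1)) ≤ th j

/-- At its own threshold the line of the top agent is active. If its root is not larger, the range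
there already gets to agent `i + 1`; by `between` the same holds for the skipped agents with their
larger thresholds. -/
theorem ThresholdStack.pop {i v : ℕ} {z th : ℕ → ℝ} {st : ℕ → ℕ} (h : ThresholdStack th i st v)
    (hth : IsThreshold (i + 1) z th) {w : ℕ} (hw : w + 1 ≤ v)
    (hr : root z (st (w + 1)) i ≤ th (st (w + 1)))
    (hd : ∀ j, st (w + 1) < j → j ≤ i → z (i + 1) ≤ reach z (th j) i) {j : ℕ} (hj : st w < j)
    (hji : j ≤ i) : z (i + 1) ≤ reach z (th j) i := by
  have hle : st (w + 1) ≤ i := h.top ▸ h.mono _ _ hw le_rfl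
  have h1 : z (i + 1) ≤ reach z (th (st (w + 1))) i := by
    rw [hth.reach_eq_line hle (by omega) le_rfl (h.later _ hw), ← line_root z hle]
    exact (line_strictMono z _ _).monotone hr
  rcases lt_trichotomy j (st (w + 1)) with h2 | h2 | h2
  · exact h1.trans ((reach_strictMono z i).monotone (h.between w (by omega) j hj h2))
  · rwa [h2]
  · exact hd j h2 hji

/-- The root of the first surviving line is the new threshold. It is at most the thresholds of all
removed agents, which gives `between` for the new entry. -/
theorem ThresholdStack.push {n i v : ℕ} {z th : ℕ → ℝ} {st : ℕ → ℕ} (hz : Increasing n z)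
    (hi : i + 1 < n) (h : ThresholdStack th i st v) (hth : IsThreshold (i + 1) z th) {w : ℕ}
    (hw : w ≤ v) (hr : w ≠ 0 → th (st w) ≤ root z (st w) i)
    (hd : ∀ j, st w < j → j ≤ i → z (i + 1) ≤ reach z (th j) i) :
    IsThreshold (i + 2) z (Function.update th (i + 1) (root z (st w) i)) ∧
      ThresholdStack (Function.update th (i + 1) (root z (st w) i)) (i + 1)
        (Function.update st (w + 1) (i + 1)) (w + 1) := by
  have hle : st w ≤ i := h.top ▸ h.mono _ _ hw le_rfl
  have hr' : th (st w) ≤ root z (st w) i := by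
    by_cases h0 : w = 0
    · subst h0
      rw [h.zero, hth.zero]
      exact root_zero_nonneg hz hi
    · exact hr h0
  obtain ⟨h1, h2⟩ := hth.extend hle hr' (line_root z hle) hd
  set r := root z (st w) i
  have hst : ∀ a ≤ w, Function.update st (w + 1) (i + 1) a = st a := fun a ha =>
    Function.update_of_ne (by omega) _ _
  have hstw : Function.update st (w + 1) (i + 1) (w + 1) = i + 1 := Function.update_self _ _ _
  have hup : ∀ j ≤ i, Function.update th (i + 1) r j = th j := fun j hj =>
    Function.update_of_ne (by omega) _ _
  have hupi : Function.update th (i + 1) r (i + 1) = r := Function.update_self _ _ _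
  have hsti : ∀ a ≤ w, st a ≤ i := fun a ha => (h.mono _ _ ha hw).trans hle
  refine ⟨⟨by rw [hup 0 (by omega), hth.zero], fun k hk => ?_⟩, ⟨?_, hstw, ?_, ?_, ?_⟩⟩
  · rcases (by omega : k = i ∨ k < i) with rfl | hk
    · rw [hupi, h1]
    · rw [hup _ hk, hth.succ k (by omega)]
  · rw [hst 0 (by omega), h.zero]
  · intro a b hab hb
    rcases (by omega : b = w + 1 ∨ b ≤ w) with rfl | hb'
    · rw [hstw]
      rcases hab.eq_or_lt with rfl | hab
      · rw [hstw]
      · rw [hst a (by omega)]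
        exact (hsti a (by omega)).trans (by omega)
    · rw [hst b hb', hst a (by omega)]
      exact h.mono a b hab (by omega)
  · intro a ha j hj hji
    rcases (by omega : a = w + 1 ∨ a ≤ w) with rfl | ha'
    · rw [hstw] at hj; omega
    · rw [hst a ha'] at hj ⊢
      rw [hup _ (hsti a ha')]
      rcases (by omega : j = i + 1 ∨ j ≤ i) with rfl | hji'
      · rw [hupi]
        refine le_trans ?_ hr'
        rcases (h.mono a w ha' hw).eq_or_lt with he | hlt
        · rw [he]
        · exact h.later a (by omega) _ hlt hle
      · rw [hup _ hji']
        exact h.later a (by omega) j hj hji'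
  · intro a ha j hj hja
    rcases (by omega : a = w ∨ a + 1 ≤ w) with rfl | ha'
    · rw [hstw] at hja ⊢
      rw [hst a le_rfl] at hj
      rw [hupi, hup j (by omega)]
      exact h2 j hj (by omega)
    · rw [hst _ ha'] at hja ⊢
      rw [hst a (by omega)] at hj
      have := hsti _ ha'
      rw [hup _ this, hup j (by omega)]
      exact h.between a (by omega) j hj hja

/-! ### The search for the optimal power -/

/-- The power for which the sum of two lines vanishes. -/
noncomputable def meetRoot (z z' : ℕ → ℝ) (k q c m : ℕ) : ℝ :=
  (weight z q + weight z' m - 2 ^ (q - k) * (z k + weight z k) -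
    2 ^ (m - c) * (z' c + weight z' c)) / (2 ^ (q - k + 1) + 2 ^ (m - c + 1) - 2)

theorem line_add_line_meetRoot (z z' : ℕ → ℝ) (k q c m : ℕ) :
    line z k q (meetRoot z z' k q c m) + line z' c m (meetRoot z z' k q c m) = 0 := by
  have h1 := one_le_two_pow_succ_sub_one (q - k)
  have h2 := one_le_two_pow_succ_sub_one (m - c)
  have h3 : ((2 : ℝ) ^ (q - k + 1) + 2 ^ (m - c + 1) - 2) * meetRoot z z' k q c m = _ :=
    mul_div_cancel₀ _ (by linarith)
  simp only [line]
  linarith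

/-- The state of the search.  All splits before `q` have been considered; `p` and `P` are the
best split and its power.  The stack, up to `v`, holds the agents before `e` with thresholds below
`P`, and `c` is the last agent of the reflected configuration in question with this property. -/
structure Search (n : ℕ) (x th th' : ℕ → ℝ) (st : ℕ → ℕ) (e q v c p : ℕ) (P : ℝ) : Prop where
  zero : st 0 = 0
  le : ∀ a ≤ v, st a ≤ q
  between : ∀ a < v, ∀ j, st a < j → j < st (a + 1) → P ≤ th j
  later : ∀ j, st v < j → j < e → P ≤ th j
  later' : ∀ j, c < j → j ≤ n - 2 - q → P ≤ th' j
  one_le : 1 ≤ p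
  succ_le : p + 1 ≤ n
  excess_nonneg : 0 ≤ excess n x P (p - 1)
  excess_nonpos : ∀ r < q, excess n x P r ≤ 0

section Search

variable {n e q v c p : ℕ} {x th th' : ℕ → ℝ} {st : ℕ → ℕ} {P : ℝ}

theorem Search.pos (h : Search n x th th' st e q v c p P) (hx : Increasing n x) : 0 < P :=
  pos_of_excess_nonneg hx (by have := h.one_le; have := h.succ_le; omega) h.excess_nonneg

/-- Agent `q` enters untested, since its threshold is compared with `P` only when it is on top. The
minimum accounts for the shrinking reflected side. -/
theorem Search.push (h : Search n x th th' st q q v c p P) :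
    Search n x th th' (Function.update st (v + 1) q) (q + 1) q (v + 1) (min c (n - 2 - q)) p P := by
  have hst : ∀ a ≤ v, Function.update st (v + 1) q a = st a := fun a ha =>
    Function.update_of_ne (by omega) _ _
  have hstw : Function.update st (v + 1) q (v + 1) = q := Function.update_self _ _ _
  refine ⟨by rw [hst 0 (by omega), h.zero], fun a ha => ?_, fun a ha j hj hja => ?_,
    fun j hj hjq => ?_, fun j hj hjn => ?_, h.one_le, h.succ_le, h.excess_nonneg, h.excess_nonpos⟩
  · rcases (by omega : a = v + 1 ∨ a ≤ v) with rfl | ha'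
    · rw [hstw]
    · rw [hst a ha']; exact h.le a ha'
  · rw [hst a (by omega)] at hj
    rcases (by omega : a = v ∨ a + 1 ≤ v) with rfl | ha'
    · rw [hstw] at hja
      exact h.later j hj hja
    · rw [hst _ ha'] at hja
      exact h.between a ha' j hj hja
  · rw [hstw] at hj; omega
  · exact h.later' j (by omega) hjn

theorem Search.pop (h : Search n x th th' st e q (v + 1) c p P) (hP : P ≤ th (st (v + 1))) :
    Search n x th th' st e q v c p P := by
  refine ⟨h.zero, fun a ha => h.le a (by omega), fun a ha => h.between a (by omega),
    fun j hj hje => ?_, h.later', h.one_le, h.succ_le, h.excess_nonneg, h.excess_nonpos⟩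
  rcases lt_trichotomy j (st (v + 1)) with h2 | rfl | h2
  · exact h.between v (by omega) j hj h2
  · exact hP
  · exact h.later j h2 hje

theorem Search.pred (h : Search n x th th' st e q v (c + 1) p P) (hP : P ≤ th' (c + 1)) :
    Search n x th th' st e q v c p P := by
  refine ⟨h.zero, h.le, h.between, h.later, fun j hj hjn => ?_, h.one_le, h.succ_le,
    h.excess_nonneg, h.excess_nonpos⟩
  rcases (by omega : j = c + 1 ∨ c + 1 < j) with rfl | h2
  · exact hP
  · exact h.later' j h2 hjn

/-- Between the larger of the two current thresholds and `P`, both ranges are single lines, so the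
excess is affine in `Q`. -/
theorem Search.excess_eq (h : Search n x th th' st (q + 1) q v c p P) (hth : IsThreshold n x th)
    (hth' : IsThreshold n (mirror n x) th') (hq : q + 2 ≤ n) (hc : c ≤ n - 2 - q) {Q : ℝ}
    (hQ : Q ≤ P) (h1 : th (st v) ≤ Q) (h2 : th' c ≤ Q) :
    excess n x Q q = line x (st v) q Q + line (mirror n x) c (n - 2 - q) Q := by
  rw [excess, hth.reach_eq_line (h.le v le_rfl) (by omega) h1
    fun j hj hjq => hQ.trans (h.later j hj (by omega)),
    hth'.reach_eq_line hc (by omega) h2 fun j hj hjq => hQ.trans (h.later' j hj hjq)]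

/-- The bounds `h1` and `h2` keep both lines active at `Q`, and `h3` keeps the excess of the new
split nonnegative. -/
theorem Search.improve (h : Search n x th th' st (q + 1) q v c p P) (hth : IsThreshold n x th)
    (hth' : IsThreshold n (mirror n x) th') (hq : q + 2 ≤ n) (hc : c ≤ n - 2 - q) {Q : ℝ}
    (hQ : Q ≤ P) (h1 : th (st v) ≤ Q) (h2 : th' c ≤ Q)
    (h3 : meetRoot x (mirror n x) (st v) q c (n - 2 - q) ≤ Q) :
    Search n x th th' st (q + 1) q v c (q + 1) Q := by
  refine ⟨h.zero, h.le, fun a ha j hj hja => hQ.trans (h.between a ha j hj hja),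
    fun j hj hje => hQ.trans (h.later j hj hje), fun j hj hjn => hQ.trans (h.later' j hj hjn),
    by omega, by omega, ?_,
    fun r hr => ((excess_strictMono n x r).monotone hQ).trans (h.excess_nonpos r hr)⟩
  rw [Nat.add_sub_cancel, h.excess_eq hth hth' hq hc hQ h1 h2, ← line_add_line_meetRoot x
    (mirror n x) (st v) q c (n - 2 - q)]
  exact add_le_add ((line_strictMono _ _ _).monotone h3) ((line_strictMono _ _ _).monotone h3)

/-- The excess of split `q` is now nonpositive, and it remains so because `P` only decreases. -/
theorem Search.next (h : Search n x th th' st (q + 1) q v c p P) (hth : IsThreshold n x th)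
    (hth' : IsThreshold n (mirror n x) th') (hq : q + 2 ≤ n) (hc : c ≤ n - 2 - q)
    (h1 : th (st v) ≤ P) (h2 : th' c ≤ P)
    (h3 : P ≤ meetRoot x (mirror n x) (st v) q c (n - 2 - q)) :
    Search n x th th' st (q + 1) (q + 1) v c p P := by
  refine ⟨h.zero, fun a ha => (h.le a ha).trans (by omega), h.between, h.later,
    fun j hj hjn => h.later' j hj (by omega), h.one_le, h.succ_le, h.excess_nonneg,
    fun r hr => ?_⟩
  rcases (by omega : r = q ∨ r < q) with rfl | hr
  · rw [h.excess_eq hth hth' hq hc le_rfl h1 h2, ← line_add_line_meetRoot x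
      (mirror n x) (st v) r c (n - 2 - r)]
    exact add_le_add ((line_strictMono _ _ _).monotone h3) ((line_strictMono _ _ _).monotone h3)
  · exact h.excess_nonpos r hr

/-- With such power every agent gets the information at its own start. -/
theorem le_reach_of_large {z : ℕ → ℝ} (hz : Increasing n z) (hP : z (n - 1) - z 0 ≤ P) {i : ℕ}
    (hi : i < n) : z i + P ≤ reach z P i := by
  induction i with
  | zero => rw [reach]
  | succ i ih =>
    have h1 := ih (by omega)
    have h2 := hz.le (Nat.zero_le i) (by omega)
    have h3 := hz.le (by omega : i + 1 ≤ n - 1) (by omega)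
    rw [reach, min_eq_right (by linarith)]
    linarith

/-- The value `n` of `c` exceeds all indices, which makes `later'` vacuous; the first `Search.push`
brings it into range. -/
theorem search_start (hn : 2 ≤ n) (hx : Increasing n x) (h0 : st 0 = 0) :
    Search n x th th' st 0 0 0 n 1 (2 * (x (n - 1) - x 0)) := by
  have h1 : x 0 < x (n - 1) := hx (by omega) (by omega)
  have h2 := le_reach_of_large hx (P := 2 * (x (n - 1) - x 0)) (by linarith) (i := 0) (by omega)
  have h3 : mirror n x (n - 1) - mirror n x 0 = x (n - 1) - x 0 := by
    simp only [mirror, Nat.sub_self, Nat.sub_zero]; ring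
  have h4 := le_reach_of_large hx.mirror (P := 2 * (x (n - 1) - x 0)) (by linarith)
    (i := n - 2) (by omega)
  have h5 : mirror n x (n - 2) = -x 1 := by rw [mirror]; congr 2; omega
  have h6 := hx.le (by omega : 1 ≤ n - 1) (by omega)
  refine ⟨h0, fun a ha => ?_, by omega, by omega, by omega, le_rfl, hn, ?_, by omega⟩
  · obtain rfl : a = 0 := by omega
    exact h0.le
  · simp only [excess, Nat.sub_self, Nat.sub_zero]
    linarith

end Search

end Convergecast

namespace RealRAM

open Convergecast

/-! ### The program -/

/-- The first cell of an array of natural numbers. -/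
def cell (a : ℕ) : NExp := .get a (.const 0)

/-- Set up the powers of two, the reflected configuration and the weighted sums. -/
def prepare : Prog :=
  .seq (.setR 5 (.const 0) (.const 1)) <|
  .seq (.setN 2 (.const 0) (.const 0)) <|
  .loop (.nle (.add (cell 2) (.const 1)) (cell 0)) <|
  .seq (.setR 5 (.add (cell 2) (.const 1)) (.mul (.const 2) (.get 5 (cell 2)))) <|
  .seq (.setR 7 (cell 2)
    (.sub (.const 0) (.get 0 (.sub (.sub (cell 0) (.const 1)) (cell 2))))) <|
  -- For agent `0` the truncated index is the cell itself, which still holds zero; the same applies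
  -- to array `8`.
  .seq (.setR 6 (cell 2)
    (.add (.mul (.const 2) (.get 6 (.sub (cell 2) (.const 1)))) (.get 0 (cell 2)))) <|
  .seq (.setR 8 (cell 2)
    (.add (.mul (.const 2) (.get 8 (.sub (cell 2) (.const 1)))) (.get 7 (cell 2))))
  (.setN 2 (.const 0) (.add (cell 2) (.const 1)))

theorem halts_prepare {σ : State} {n : ℕ} {x : ℕ → ℝ} (hn : σ.nat 0 0 = n) (hx : σ.real 0 = x)
    (h6 : σ.real 6 0 = 0) (h8 : σ.real 8 0 = 0) :
    Halts prepare σ fun τ t => (∀ a, a ≠ 2 → τ.nat a = σ.nat a) ∧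
      (∀ a, a ≠ 5 → a ≠ 6 → a ≠ 7 → a ≠ 8 → τ.real a = σ.real a) ∧
      (∀ i ≤ n, τ.real 5 i = 2 ^ i) ∧ (∀ i < n, τ.real 7 i = mirror n x i) ∧
      (∀ i < n, τ.real 6 i = weight x i) ∧ (∀ i < n, τ.real 8 i = weight (mirror n x) i) ∧
      t ≤ 200 * n + 200 := by
  let I : State → Prop := fun τ => (∀ a, a ≠ 2 → τ.nat a = σ.nat a) ∧
    (∀ a, a ≠ 5 → a ≠ 6 → a ≠ 7 → a ≠ 8 → τ.real a = σ.real a) ∧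
    ∃ i ≤ n, τ.nat 2 0 = i ∧ (∀ j ≤ i, τ.real 5 j = 2 ^ j) ∧
      (∀ j < i, τ.real 7 j = mirror n x j) ∧ (∀ j < i, τ.real 6 j = weight x j) ∧
      (∀ j < i, τ.real 8 j = weight (mirror n x) j) ∧
      (i = 0 → τ.real 6 0 = 0 ∧ τ.real 8 0 = 0)
  simp only [prepare, halts_seq, halts_setN, halts_setR, NExp.eval, RExp.eval, NExp.cost,
    RExp.cost, Nat.cast_one]
  refine (halts_loop I (fun τ => 200 * (n - τ.nat 2 0)) ?_ ?_).imp ?_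
  · refine ⟨fun a ha => by rw [setNat_nat_of_ne _ ha, setReal_nat],
      fun a h _ _ _ => by rw [setNat_real, setReal_real_of_ne _ h], 0, Nat.zero_le _, ?_⟩
    simp [setNat_real, setNat_nat_self, setReal_real_self, setReal_real_of_ne, h6, h8]
  · rintro τ ⟨hnat, hreal, i, hi, hi2, h5, h7, h6, h8, h0⟩ hc
    have e0 : τ.nat 0 0 = n := by rw [hnat 0 (by simp), hn]
    have ex : τ.real 0 = x := by rw [hreal 0 (by simp) (by simp) (by simp) (by simp), hx]
    simp only [Test.holds, cell, NExp.eval, hi2, e0] at hc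
    simp only [halts_seq, halts_setN, halts_setR, cell, NExp.eval, RExp.eval, NExp.cost,
      RExp.cost, Test.cost, hi2, e0, ex, setReal_nat, setNat_nat_self,
      setReal_real_self, setReal_real_of_ne, ne_eq, Function.update_self,
      Nat.cast_ofNat, Nat.cast_zero, not_false_eq_true, Nat.reduceEqDiff]
    refine ⟨⟨fun a ha => ?_, fun a a5 a6 a7 a8 => ?_, i + 1, hc, ?_, fun j hj => ?_, fun j hj => ?_,
      fun j hj => ?_, fun j hj => ?_, by simp⟩, by omega⟩
    · simp [setNat_nat_of_ne _ ha, setReal_nat, hnat a ha]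
    · simp [setNat_real, setReal_real_of_ne, a5, a6, a7, a8, hreal a]
    · simp [setNat_nat_self]
    · simp only [setNat_real, setReal_real_self, setReal_real_of_ne, ne_eq, not_false_eq_true,
        Nat.reduceEqDiff, Function.update_apply]
      split_ifs with hji
      · rw [hji, h5 i le_rfl, pow_succ]; ring
      · exact h5 j (by omega)
    · simp only [setNat_real, setReal_real_self, setReal_real_of_ne, ne_eq, not_false_eq_true,
        Nat.reduceEqDiff, Function.update_apply]
      split_ifs with hji
      · rw [hji, mirror, zero_sub]
      · exact h7 j (by omega)
    · simp only [setNat_real, setReal_real_self, setReal_real_of_ne, ne_eq, not_false_eq_true,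
        Nat.reduceEqDiff, Function.update_apply]
      split_ifs with hji
      · subst hji
        cases j with
        | zero => simp [(h0 rfl).1, weight]
        | succ j => simp [h6 j (by omega), weight]
      · exact h6 j (by omega)
    · simp only [setNat_real, setReal_real_self, Function.update_apply]
      split_ifs with hji
      · subst hji
        cases j with
        | zero => simp [(h0 rfl).2, weight, mirror]
        | succ j => simp [h8 j (by omega), weight, mirror]
      · exact h8 j (by omega)
  · rintro τ t ⟨⟨hnat, hreal, i, hi, hi2, h5, h7, h6, h8, h0⟩, hc, ht⟩
    have e0 : τ.nat 0 0 = n := by rw [hnat 0 (by simp), hn]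
    simp only [Test.holds, cell, NExp.eval, hi2, e0] at hc
    obtain rfl : i = n := by omega
    refine ⟨hnat, hreal, h5, h7, h6, h8, ?_⟩
    simp only [Test.cost, cell, NExp.cost, setNat_nat_self, Function.update_self] at ht
    omega

/-! ### Program for the thresholds -/

/-- The agent on top of the stack. -/
def top : NExp := .get 4 (cell 3)

/-- The power for which the line of the agent on top of the stack ends at the current agent. -/
def rootExp (X U : ℕ) : RExp :=
  -- Cell `2` holds `i + 1` when `root z k i` is computed.
  .div (.sub (.add (.get X (cell 2)) (.get U (.sub (cell 2) (.const 1))))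
      (.mul (.get 5 (.sub (.sub (cell 2) (.const 1)) top)) (.add (.get X top) (.get U top))))
    (.sub (.get 5 (.sub (cell 2) top)) (.const 1))

/-- Remove the agents from the stack whose lines do not contribute any more. -/
def popLoop (X U T : ℕ) : Prog :=
  .loop (.and (.nle (.const 1) (cell 3)) (.rle (rootExp X U) (.get T top)))
    (.setN 3 (.const 0) (.sub (cell 3) (.const 1)))

/-- Compute the thresholds of the configuration in the array `X`, whose weighted sums are in the
array `U`, and store them in the array `T`. -/
def thresholds (X U T : ℕ) : Prog :=
  .seq (.setN 3 (.const 0) (.const 0)) <|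
  .seq (.setN 4 (.const 0) (.const 0)) <|
  .seq (.setR T (.const 0) (.const 0)) <|
  .seq (.setN 2 (.const 0) (.const 1)) <|
  .loop (.nle (.add (cell 2) (.const 1)) (cell 0)) <|
  .seq (popLoop X U T) <|
  .seq (.setR T (cell 2) (rootExp X U)) <|
  .seq (.setN 3 (.const 0) (.add (cell 3) (.const 1))) <|
  .seq (.setN 4 (cell 3) (cell 2))
  (.setN 2 (.const 0) (.add (cell 2) (.const 1)))

theorem eval_rootExp {σ : State} {X U i n : ℕ} {z : ℕ → ℝ} (hX : ∀ i < n, σ.real X i = z i)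
    (hU : ∀ i < n, σ.real U i = weight z i) (h5 : ∀ i ≤ n, σ.real 5 i = 2 ^ i) (hi : i + 1 < n)
    (h2 : σ.nat 2 0 = i + 1) (hk : σ.nat 4 (σ.nat 3 0) ≤ i) :
    (rootExp X U).eval σ = root z (σ.nat 4 (σ.nat 3 0)) i := by
  simp only [rootExp, top, cell, RExp.eval, NExp.eval, h2, Nat.add_sub_cancel, root]
  rw [hX _ hi, hU _ (by omega), hX _ (by omega), hU _ (by omega), h5 _ (by omega),
    h5 _ (by omega), Nat.cast_one]

theorem halts_popLoop {σ : State} {X U T i v n : ℕ} {z : ℕ → ℝ} {st : ℕ → ℕ}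
    (hX : ∀ i < n, σ.real X i = z i) (hU : ∀ i < n, σ.real U i = weight z i)
    (h5 : ∀ i ≤ n, σ.real 5 i = 2 ^ i) (hi : i + 1 < n) (h2 : σ.nat 2 0 = i + 1)
    (h3 : σ.nat 3 0 = v) (h4 : σ.nat 4 = st) (hth : IsThreshold (i + 1) z (σ.real T))
    (hst : ThresholdStack (σ.real T) i st v) :
    Halts (popLoop X U T) σ fun τ t => ∃ w ≤ v, τ = σ.setNat 3 0 w ∧
      (w ≠ 0 → σ.real T (st w) ≤ root z (st w) i) ∧
      (∀ j, st w < j → j ≤ i → z (i + 1) ≤ reach z (σ.real T j) i) ∧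
      t + 200 * w ≤ 200 * v + 200 := by
  let I : State → Prop := fun τ => ∃ w ≤ v, τ = σ.setNat 3 0 w ∧
    ∀ j, st w < j → j ≤ i → z (i + 1) ≤ reach z (σ.real T j) i
  have hle : ∀ w ≤ v, st w ≤ i := fun w hw => hst.top ▸ hst.mono _ _ hw le_rfl
  have hev : ∀ w ≤ v, (rootExp X U).eval (σ.setNat 3 0 w) = root z (st w) i := by
    intro w hw
    have := eval_rootExp (σ := σ.setNat 3 0 w) hX hU h5 hi
      (by simpa [setNat_nat_of_ne] using h2)
      (by simpa [setNat_nat_of_ne, setNat_nat_self, h4] using hle w hw)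
    simpa [setNat_nat_of_ne, setNat_nat_self, h4] using this
  have hcond : ∀ w ≤ v, (Test.and (.nle (.const 1) (cell 3))
      (.rle (rootExp X U) (.get T top))).holds (σ.setNat 3 0 w) ↔
      1 ≤ w ∧ root z (st w) i ≤ σ.real T (st w) := by
    intro w hw
    simp only [Test.holds, hev w hw]
    simp [NExp.eval, RExp.eval, cell, top, setNat_nat_self, setNat_real, setNat_nat_of_ne, h4]
  refine (halts_loop I (fun τ => 200 * τ.nat 3 0) ?_ ?_).imp ?_
  · refine ⟨v, le_rfl, ?_, fun j hj hji => by rw [hst.top] at hj; omega⟩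
    cases σ
    subst h3
    simp [State.setNat]
  · rintro τ ⟨w, hw, rfl, hd⟩ hc
    rw [hcond w hw] at hc
    obtain ⟨w, rfl⟩ : ∃ k, w = k + 1 := ⟨w - 1, by omega⟩
    rw [halts_setN]
    refine ⟨⟨w, by omega, ?_, fun j => hst.pop hth hw hc.2 hd⟩, ?_⟩
    · simp [NExp.eval, cell, State.setNat]
    · simp only [Test.cost, RExp.cost, NExp.cost, cell, top, rootExp, NExp.eval, setNat_nat_self,
        Function.update_self]
      omega
  · rintro τ t ⟨⟨w, hw, rfl, hd⟩, hc, ht⟩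
    rw [hcond w hw] at hc
    refine ⟨w, hw, rfl, fun h0 => ?_, hd, ?_⟩
    · by_contra! h
      exact hc ⟨by omega, h.le⟩
    · simp only [Test.cost, RExp.cost, NExp.cost, cell, top, rootExp, setNat_nat_self,
        Function.update_self, h3] at ht
      omega

theorem halts_thresholds {σ : State} {X U T n : ℕ} {z : ℕ → ℝ} (hn1 : 1 ≤ n) (hz : Increasing n z)
    (hn : σ.nat 0 0 = n) (hXT : X ≠ T) (hUT : U ≠ T) (h5T : 5 ≠ T)
    (hX : ∀ i < n, σ.real X i = z i) (hU : ∀ i < n, σ.real U i = weight z i)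
    (h5 : ∀ i ≤ n, σ.real 5 i = 2 ^ i) :
    Halts (thresholds X U T) σ fun τ t => (∀ a, a ≠ 2 → a ≠ 3 → a ≠ 4 → τ.nat a = σ.nat a) ∧
      (∀ a, a ≠ T → τ.real a = σ.real a) ∧ IsThreshold n z (τ.real T) ∧
      t ≤ 1000 * n + 1000 := by
  let I : State → Prop := fun τ => (∀ a, a ≠ 2 → a ≠ 3 → a ≠ 4 → τ.nat a = σ.nat a) ∧
    (∀ a, a ≠ T → τ.real a = σ.real a) ∧
    ∃ i < n, τ.nat 2 0 = i + 1 ∧ IsThreshold (i + 1) z (τ.real T) ∧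
      ThresholdStack (τ.real T) i (τ.nat 4) (τ.nat 3 0)
  simp only [thresholds, halts_seq, halts_setN, halts_setR, NExp.eval, RExp.eval, NExp.cost,
    RExp.cost, Nat.cast_zero]
  -- The stack height is part of the potential: each round pushes one agent, and the push pays for
  -- its later removal.
  refine (halts_loop I (fun τ => 1000 * (n - τ.nat 2 0) + 200 * τ.nat 3 0) ?_ ?_).imp ?_
  · refine ⟨fun a h2 h3 h4 => by simp [setNat_nat_of_ne, setReal_nat, h2, h3, h4],
      fun a h => by simp [setNat_real, setReal_real_of_ne _ h], 0, by omega, ?_, ?_, ?_⟩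
    · simp [setNat_nat_self]
    · exact ⟨by simp [setNat_real, setReal_real_self], fun k hk => by omega⟩
    · simp only [setNat_nat_of_ne, setReal_nat, setNat_nat_self, Function.update_self, ne_eq,
        Nat.reduceEqDiff, not_false_eq_true]
      refine ⟨by simp, by simp, fun a b _ _ => ?_, fun a _ j h1 h2 => ?_, fun a h => by omega⟩
      · obtain ⟨rfl, rfl⟩ : a = 0 ∧ b = 0 := by omega
        exact le_rfl
      · omega
  · rintro τ ⟨hnat, hreal, i, hi, h2, hth, hst⟩ hc
    have e0 : τ.nat 0 0 = n := by rw [hnat 0 (by simp) (by simp) (by simp), hn]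
    simp only [Test.holds, cell, NExp.eval, h2, e0] at hc
    have hX' : ∀ i < n, τ.real X i = z i := by rwa [hreal X hXT]
    have hU' : ∀ i < n, τ.real U i = weight z i := by rwa [hreal U hUT]
    have h5' : ∀ i ≤ n, τ.real 5 i = 2 ^ i := by rwa [hreal 5 h5T]
    rw [halts_seq]
    refine (halts_popLoop hX' hU' h5' (by omega) h2 rfl rfl hth hst).imp ?_
    rintro τ' t ⟨w, hw, rfl, hr, hd, ht⟩
    obtain ⟨p1, p2⟩ := hst.push hz (by omega) hth hw hr hd
    have hle : τ.nat 4 w ≤ i := hst.top ▸ hst.mono _ _ hw le_rfl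
    have hev : (rootExp X U).eval (τ.setNat 3 0 w) = root z (τ.nat 4 w) i := by
      have := eval_rootExp (σ := τ.setNat 3 0 w) hX' hU' h5' (i := i) (by omega)
        (by simpa [setNat_nat_of_ne] using h2)
        (by simpa [setNat_nat_of_ne, setNat_nat_self] using hle)
      simpa [setNat_nat_of_ne, setNat_nat_self] using this
    simp only [halts_seq, halts_setN, halts_setR, cell, NExp.eval, hev, NExp.cost,
      Test.cost, h2, setReal_nat, setNat_nat_self, setNat_nat_of_ne, ne_eq,
      Function.update_self, not_false_eq_true, Nat.reduceEqDiff]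
    refine ⟨⟨fun a h2 h3 h4 => ?_, fun a h => ?_, i + 1, by omega, ?_, ?_, ?_⟩, ?_⟩
    · simp [setNat_nat_of_ne, setReal_nat, h2, h3, h4, hnat a]
    · simp [setNat_real, setReal_real_of_ne _ h, hreal a h]
    · simp [setNat_nat_self]
    · simpa only [setNat_real, setReal_real_self] using p1
    · simpa [setNat_real, setReal_real_self, setNat_nat_self, setNat_nat_of_ne, setReal_nat]
        using p2
    · simp only [rootExp, top, cell, RExp.cost, NExp.cost]
      omega
  · rintro τ t ⟨⟨hnat, hreal, i, hi, h2, hth, hst⟩, hc, ht⟩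
    have e0 : τ.nat 0 0 = n := by rw [hnat 0 (by simp) (by simp) (by simp), hn]
    simp only [Test.holds, cell, NExp.eval, h2, e0] at hc
    obtain rfl : i + 1 = n := by omega
    refine ⟨hnat, hreal, hth, ?_⟩
    simp only [Test.cost, cell, NExp.cost, setNat_nat_self, setNat_nat_of_ne, setReal_nat, ne_eq,
      Function.update_self, not_false_eq_true, Nat.reduceEqDiff] at ht
    omega

theorem setReal_setReal (σ : State) (a i : ℕ) (v w : ℝ) :
    (σ.setReal a i v).setReal a i w = σ.setReal a i w := by
  simp [State.setReal]

/-! ### Program for the search -/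

/-- The search for the optimal power can start. -/
structure Ready (n : ℕ) (x : ℕ → ℝ) (σ : State) : Prop where
  size : σ.nat 0 0 = n
  conf : σ.real 0 = x
  pow : ∀ i ≤ n, σ.real 5 i = 2 ^ i
  reflected : ∀ i < n, σ.real 7 i = mirror n x i
  weights : ∀ i < n, σ.real 6 i = weight x i
  weights' : ∀ i < n, σ.real 8 i = weight (mirror n x) i
  isThreshold : IsThreshold n x (σ.real 9)
  isThreshold' : IsThreshold n (mirror n x) (σ.real 10)

theorem Ready.congr {n : ℕ} {x : ℕ → ℝ} {σ τ : State} (h : Ready n x σ)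
    (h0 : τ.nat 0 = σ.nat 0) (hr : ∀ a, a ≠ 1 → τ.real a = σ.real a) : Ready n x τ := by
  refine ⟨by rw [h0, h.size], by rw [hr 0 (by simp), h.conf], ?_, ?_, ?_, ?_, ?_, ?_⟩
  · rw [hr 5 (by simp)]; exact h.pow
  · rw [hr 7 (by simp)]; exact h.reflected
  · rw [hr 6 (by simp)]; exact h.weights
  · rw [hr 8 (by simp)]; exact h.weights'
  · rw [hr 9 (by simp)]; exact h.isThreshold
  · rw [hr 10 (by simp)]; exact h.isThreshold'

/-- The last agent of the reflected configuration that moves when the agents up to the current one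
push the information of the first agent. -/
def opposite : NExp := .sub (.sub (cell 0) (.const 2)) (cell 2)

/-- The power for which the two current lines meet. -/
def meetExp : RExp :=
  .div
    (.sub (.sub (.add (.get 6 (cell 2)) (.get 8 opposite))
      (.mul (.get 5 (.sub (cell 2) top)) (.add (.get 0 top) (.get 6 top))))
      (.mul (.get 5 (.sub opposite (cell 5))) (.add (.get 7 (cell 5)) (.get 8 (cell 5)))))
    (.sub (.add (.get 5 (.add (.sub (cell 2) top) (.const 1)))
      (.get 5 (.add (.sub opposite (cell 5)) (.const 1)))) (.const 2))

/-- The current best power. -/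
def power : RExp := .get 1 (.const 0)

/-- Replace the current best power by the larger of this and the value of `e`. -/
def raise (e : RExp) : Prog := .cond (.rle power e) (.setR 1 (.const 0) e) .skip

/-- One step towards the power for which the current split is optimal. -/
def improve : Prog :=
  .seq (.setN 1 (.const 0) (.add (cell 2) (.const 1))) <|
  .seq (.setR 1 (.const 0) meetExp) <|
  .seq (raise (.get 9 top)) (raise (.get 10 (cell 5)))

/-- Lower the power until the current split is not better any more. -/
def searchLoop : Prog :=
  .loop (.not (.and (.not (.rle power (.get 9 top)))
    (.and (.not (.rle power (.get 10 (cell 5)))) (.rle power meetExp)))) <|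
  .cond (.rle power (.get 9 top)) (.setN 3 (.const 0) (.sub (cell 3) (.const 1))) <|
  .cond (.rle power (.get 10 (cell 5))) (.setN 5 (.const 0) (.sub (cell 5) (.const 1))) improve

/-- Compute the optimal power and the split. -/
def search : Prog :=
  -- For `n = 1` this value is `0`, the loop is not entered, and the initial values are already the
  -- output.
  .seq (.setR 1 (.const 0) (.mul (.const 2)
    (.sub (.get 0 (.sub (cell 0) (.const 1))) (.get 0 (.const 0))))) <|
  .seq (.setN 1 (.const 0) (.const 1)) <|
  .seq (.setN 2 (.const 0) (.const 0)) <|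
  .seq (.setN 3 (.const 0) (.const 0)) <|
  .seq (.setN 4 (.const 0) (.const 0)) <|
  .seq (.setN 5 (.const 0) (cell 0)) <|
  .loop (.nle (.add (cell 2) (.const 2)) (cell 0)) <|
  .seq (.setN 3 (.const 0) (.add (cell 3) (.const 1))) <|
  .seq (.setN 4 (cell 3) (cell 2)) <|
  .seq (.cond (.nle opposite (cell 5)) (.setN 5 (.const 0) opposite) .skip) <|
  .seq searchLoop
  (.setN 2 (.const 0) (.add (cell 2) (.const 1)))

theorem eval_meetExp {σ : State} {n q : ℕ} {x : ℕ → ℝ} (h : Ready n x σ) (hq : q + 2 ≤ n)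
    (h2 : σ.nat 2 0 = q) (hk : σ.nat 4 (σ.nat 3 0) ≤ q) (hc : σ.nat 5 0 ≤ n - 2 - q) :
    meetExp.eval σ =
      meetRoot x (mirror n x) (σ.nat 4 (σ.nat 3 0)) q (σ.nat 5 0) (n - 2 - q) := by
  simp only [meetExp, opposite, top, cell, RExp.eval, NExp.eval, h2, h.size, meetRoot, h.conf]
  rw [h.weights _ (by omega), h.weights' _ (by omega), h.pow _ (by omega), h.weights _ (by omega),
    h.pow _ (by omega), h.reflected _ (by omega), h.weights' _ (by omega), h.pow _ (by omega),
    h.pow _ (by omega), Nat.cast_ofNat]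

open Classical in
theorem halts_searchLoop {σ : State} {n q : ℕ} {x : ℕ → ℝ} (hx : Increasing n x)
    (h : Ready n x σ) (hq : q + 2 ≤ n) (h2 : σ.nat 2 0 = q) (hc : σ.nat 5 0 ≤ n - 2 - q)
    (hS : Search n x (σ.real 9) (σ.real 10) (σ.nat 4) (q + 1) q (σ.nat 3 0) (σ.nat 5 0)
      (σ.nat 1 0) (σ.real 1 0)) :
    Halts searchLoop σ fun τ t => (∀ a, a ≠ 1 → a ≠ 3 → a ≠ 5 → τ.nat a = σ.nat a) ∧
      (∀ a, a ≠ 1 → τ.real a = σ.real a) ∧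
      Search n x (σ.real 9) (σ.real 10) (σ.nat 4) (q + 1) (q + 1) (τ.nat 3 0) (τ.nat 5 0)
        (τ.nat 1 0) (τ.real 1 0) ∧
      t + 1200 * (τ.nat 3 0 + τ.nat 5 0) ≤ 1200 * (σ.nat 3 0 + σ.nat 5 0) + 1200 := by
  set th := σ.real 9 with hth
  set th' := σ.real 10 with hth'
  set st := σ.nat 4 with hst
  have z9 : th 0 = 0 := h.isThreshold.zero
  have z10 : th' 0 = 0 := h.isThreshold'.zero
  let I : State → Prop := fun τ => (∀ a, a ≠ 1 → a ≠ 3 → a ≠ 5 → τ.nat a = σ.nat a) ∧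
    (∀ a, a ≠ 1 → τ.real a = σ.real a) ∧ τ.nat 5 0 ≤ n - 2 - q ∧
    Search n x th th' st (q + 1) q (τ.nat 3 0) (τ.nat 5 0) (τ.nat 1 0) (τ.real 1 0)
  let r : State → ℝ := fun τ => meetRoot x (mirror n x) (st (τ.nat 3 0)) q (τ.nat 5 0) (n - 2 - q)
  have e1 : ∀ τ, I τ → ((Test.rle power (.get 9 top)).holds τ ↔
      τ.real 1 0 ≤ th (st (τ.nat 3 0))) := by
    rintro τ ⟨hnat, hreal, -⟩
    simp [Test.holds, power, top, cell, RExp.eval, NExp.eval, hnat, hreal, hth, hst]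
  have e2 : ∀ τ, I τ → ((Test.rle power (.get 10 (cell 5))).holds τ ↔
      τ.real 1 0 ≤ th' (τ.nat 5 0)) := by
    rintro τ ⟨hnat, hreal, -⟩
    simp [Test.holds, power, cell, RExp.eval, NExp.eval, hreal, hth']
  have em : ∀ τ, I τ → meetExp.eval τ = r τ := by
    rintro τ ⟨hnat, hreal, hc, hS⟩
    rw [eval_meetExp (h.congr (hnat 0 (by simp) (by simp) (by simp)) hreal) hq
      (by rw [hnat 2 (by simp) (by simp) (by simp), h2])
      (by rw [hnat 4 (by simp) (by simp) (by simp)]; exact hS.le _ le_rfl) hc,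
      hnat 4 (by simp) (by simp) (by simp)]
  have e3 : ∀ τ, I τ → ((Test.rle power meetExp).holds τ ↔ τ.real 1 0 ≤ r τ) := by
    intro τ hI
    rw [Test.holds, em τ hI]
    rfl
  -- A live state allows an improvement. Afterwards `P` equals one of the three bounds and the state
  -- is not live, so a second improvement needs a removal in between; the indicator charges it to
  -- that removal.
  let live : State → Prop := fun τ => th (st (τ.nat 3 0)) < τ.real 1 0 ∧
    th' (τ.nat 5 0) < τ.real 1 0 ∧ r τ < τ.real 1 0
  let ind : State → ℕ := fun τ => if live τ then 1 else 0
  have ind_le : ∀ τ, ind τ ≤ 1 := fun τ => by simp only [ind]; split_ifs <;> simp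
  refine (halts_loop I (fun τ => 1200 * (τ.nat 3 0 + τ.nat 5 0) + 600 * ind τ) ?_ ?_).imp ?_
  · exact ⟨fun _ _ _ _ => rfl, fun _ _ => rfl, hc, hS⟩
  · intro τ hI hcond
    have hloop := hcond
    simp only [Test.holds] at hloop
    rw [halts_cond, halts_cond]
    have f1 := e1 τ hI
    have f2 := e2 τ hI
    have f3 := e3 τ hI
    have hm := em τ hI
    obtain ⟨hnat, hreal, hc, hS⟩ := hI
    have hP := hS.pos hx
    refine ⟨fun d1 => ?_, fun d1 => ⟨fun d2 => ?_, fun d2 => ?_⟩⟩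
    · rw [f1] at d1
      -- The bottom agent has threshold `0 < P`, so the stack is never emptied below it.
      have hv : τ.nat 3 0 ≠ 0 := fun h0 => by
        rw [h0, hS.zero, z9] at d1
        linarith
      obtain ⟨v, hv⟩ := Nat.exists_eq_succ_of_ne_zero hv
      rw [hv] at hS d1
      rw [halts_setN]
      refine ⟨⟨fun a h1 h3 h5 => ?_, fun a ha => hreal a ha, ?_, ?_⟩, ?_⟩
      · rw [setNat_nat_of_ne _ h3, hnat a h1 h3 h5]
      · simpa [setNat_nat_of_ne] using hc
      · simpa [setNat_nat_of_ne, setNat_nat_self, setNat_real, NExp.eval, cell, hv]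
          using hS.pop d1
      · have := ind_le (τ.setNat 3 0 v)
        simp only [setNat_nat_of_ne, setNat_nat_self, NExp.eval, cell, hv, Test.cost, power, top,
          meetExp, opposite, RExp.cost, NExp.cost, Function.update_self, ne_eq, not_false_eq_true,
          Nat.reduceEqDiff, Nat.succ_eq_add_one, Nat.add_sub_cancel]
        omega
    · rw [f2] at d2
      have hv : τ.nat 5 0 ≠ 0 := fun h0 => by
        rw [h0, z10] at d2
        linarith
      obtain ⟨c, hv⟩ := Nat.exists_eq_succ_of_ne_zero hv
      rw [hv] at hS d2 hc
      rw [halts_setN]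
      refine ⟨⟨fun a h1 h3 h5 => ?_, fun a ha => hreal a ha, ?_, ?_⟩, ?_⟩
      · rw [setNat_nat_of_ne _ h5, hnat a h1 h3 h5]
      · simp [setNat_nat_self, NExp.eval, cell, hv]
        omega
      · simpa [setNat_nat_of_ne, setNat_nat_self, setNat_real, NExp.eval, cell, hv]
          using hS.pred d2
      · have := ind_le (τ.setNat 5 0 c)
        simp only [setNat_nat_of_ne, setNat_nat_self, NExp.eval, cell, hv, Test.cost, power, top,
          meetExp, opposite, RExp.cost, NExp.cost, Function.update_self, ne_eq, not_false_eq_true,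
          Nat.reduceEqDiff, Nat.succ_eq_add_one, Nat.add_sub_cancel]
        omega
    · have d3 : ¬ (Test.rle power meetExp).holds τ := fun d3 => hloop ⟨d1, d2, d3⟩
      rw [f1, not_le] at d1
      rw [f2, not_le] at d2
      rw [f3, not_le] at d3
      have hind : ind τ = 1 := if_pos ⟨d1, d2, d3⟩
      -- To be used with `Q` the maximum of the two thresholds and the meeting power, the value that
      -- `improve` leaves.
      have key : ∀ Q, Q ≤ τ.real 1 0 → th (st (τ.nat 3 0)) ≤ Q → th' (τ.nat 5 0) ≤ Q → r τ ≤ Q →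
          (Q ≤ th (st (τ.nat 3 0)) ∨ Q ≤ th' (τ.nat 5 0) ∨ Q ≤ r τ) →
          I ((τ.setNat 1 0 (q + 1)).setReal 1 0 Q) ∧
          ((τ.setNat 1 0 (q + 1)).setReal 1 0 Q).nat 3 0 = τ.nat 3 0 ∧
          ((τ.setNat 1 0 (q + 1)).setReal 1 0 Q).nat 5 0 = τ.nat 5 0 ∧
          ind ((τ.setNat 1 0 (q + 1)).setReal 1 0 Q) = 0 := by
        intro Q q1 q2 q3 q4 q5
        have n3 : ((τ.setNat 1 0 (q + 1)).setReal 1 0 Q).nat 3 0 = τ.nat 3 0 := by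
          simp [setReal_nat, setNat_nat_of_ne]
        have n5 : ((τ.setNat 1 0 (q + 1)).setReal 1 0 Q).nat 5 0 = τ.nat 5 0 := by
          simp [setReal_nat, setNat_nat_of_ne]
        have r1 : ((τ.setNat 1 0 (q + 1)).setReal 1 0 Q).real 1 0 = Q := by
          simp [setReal_real_self]
        refine ⟨⟨fun a h1 h3 h5 => ?_, fun a ha => ?_, by rwa [n5], ?_⟩, n3, n5, if_neg ?_⟩
        · rw [setReal_nat, setNat_nat_of_ne _ h1, hnat a h1 h3 h5]
        · rw [setReal_real_of_ne _ ha, setNat_real, hreal a ha]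
        · rw [n3, n5, r1]
          simpa [setReal_nat, setNat_nat_self] using
            hS.improve h.isThreshold h.isThreshold' hq hc q1 q2 q3 q4
        · simp only [live, r, n3, n5, r1]
          rintro ⟨l1, l2, l3⟩
          rcases q5 with q5 | q5 | q5 <;> linarith
      have hm' : meetExp.eval (τ.setNat 1 0 (q + 1)) = r τ := hm
      have n2 : τ.nat 2 0 = q := by rw [hnat 2 (by simp) (by simp) (by simp), h2]
      have n4 : τ.nat 4 = st := hnat 4 (by simp) (by simp) (by simp)
      have r9 : τ.real 9 = th := hreal 9 (by simp)
      have r10 : τ.real 10 = th' := hreal 10 (by simp)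
      simp only [improve, raise, halts_seq, halts_setN, halts_setR, halts_cond, halts_skip,
        Test.holds, NExp.eval, RExp.eval, cell, top, power, n2, n4, r9, r10, hm', setReal_nat,
        setNat_nat_of_ne, setNat_real, setReal_real_of_ne, setReal_real_self, setReal_setReal,
        Function.update_self, ne_eq, not_false_eq_true, Nat.reduceEqDiff, hind]
      have cost : ∀ (Q : ℝ) (k : ℕ),
          I ((τ.setNat 1 0 (q + 1)).setReal 1 0 Q) ∧
          ((τ.setNat 1 0 (q + 1)).setReal 1 0 Q).nat 3 0 = τ.nat 3 0 ∧
          ((τ.setNat 1 0 (q + 1)).setReal 1 0 Q).nat 5 0 = τ.nat 5 0 ∧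
          ind ((τ.setNat 1 0 (q + 1)).setReal 1 0 Q) = 0 → k ≤ 600 →
          I ((τ.setNat 1 0 (q + 1)).setReal 1 0 Q) ∧ k + (1200 * (τ.nat 3 0 + τ.nat 5 0) +
            600 * ind ((τ.setNat 1 0 (q + 1)).setReal 1 0 Q)) ≤
            1200 * (τ.nat 3 0 + τ.nat 5 0) + 600 * 1 := by
        rintro Q k ⟨k1, -, -, k4⟩ hk
        exact ⟨k1, by rw [k4]; omega⟩
      refine ⟨fun a1 => ⟨fun a2 => cost _ _ (key _ d2.le a2 le_rfl (a1.trans a2) ?_) (by decide),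
        fun a2 => cost _ _ (key _ d1.le le_rfl (not_le.1 a2).le a1 ?_) (by decide)⟩,
        fun a1 => ⟨fun a2 => cost _ _ (key _ d2.le ((not_le.1 a1).le.trans a2) le_rfl a2 ?_)
          (by decide),
        fun a2 => cost _ _ (key _ d3.le (not_le.1 a1).le (not_le.1 a2).le le_rfl ?_) (by decide)⟩⟩
      · exact .inr (.inl le_rfl)
      · exact .inl le_rfl
      · exact .inr (.inl le_rfl)
      · exact .inr (.inr le_rfl)
  · rintro τ t ⟨hI, hcond, ht⟩
    simp only [Test.holds, not_not] at hcond
    have f1 := e1 τ hI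
    have f2 := e2 τ hI
    have f3 := e3 τ hI
    simp only [Test.holds] at f1 f2 f3
    rw [f1, f2, f3, not_le, not_le] at hcond
    obtain ⟨hnat, hreal, hc, hS⟩ := hI
    refine ⟨hnat, hreal, hS.next h.isThreshold h.isThreshold' hq hc hcond.1.le hcond.2.1.le
      hcond.2.2, ?_⟩
    have := ind_le σ
    simp only [Test.cost, power, top, meetExp, opposite, cell, RExp.cost, NExp.cost] at ht
    omega

theorem halts_search {σ : State} {n : ℕ} {x : ℕ → ℝ} (hn : 1 ≤ n) (hx : Increasing n x)
    (h : Ready n x σ) :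
    Halts search σ fun τ t => τ.nat 0 = σ.nat 0 ∧ (∀ a, a ≠ 1 → τ.real a = σ.real a) ∧
      (n = 1 → τ.nat 1 0 = 1 ∧ τ.real 1 0 = 0) ∧
      (2 ≤ n → 1 ≤ τ.nat 1 0 ∧ τ.nat 1 0 + 1 ≤ n ∧
        excess n x (τ.real 1 0) (τ.nat 1 0 - 1) = 0 ∧
        ∀ q, q + 2 ≤ n → excess n x (τ.real 1 0) q ≤ 0) ∧
      t ≤ 10000 * n + 10000 := by
  let I : State → Prop := fun τ => τ.nat 0 = σ.nat 0 ∧ (∀ a, a ≠ 1 → τ.real a = σ.real a) ∧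
    (n = 1 → τ.nat 1 0 = 1 ∧ τ.real 1 0 = 0) ∧ τ.nat 2 0 + 1 ≤ n ∧
    (2 ≤ n → Search n x (σ.real 9) (σ.real 10) (τ.nat 4) (τ.nat 2 0) (τ.nat 2 0) (τ.nat 3 0)
      (τ.nat 5 0) (τ.nat 1 0) (τ.real 1 0))
  simp only [search, halts_seq, halts_setN, halts_setR]
  -- Each split pushes one agent, and the pointer in cell `5` only moves down from `n`; this pays
  -- for all steps of the inner loop.
  refine (halts_loop I (fun τ => 5000 * (n - τ.nat 2 0) + 1200 * (τ.nat 3 0 + τ.nat 5 0))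
    ?_ ?_).imp ?_
  · simp only [NExp.eval, RExp.eval, cell, setReal_nat, setNat_nat_of_ne, ne_eq,
      h.size, h.conf, not_false_eq_true, Nat.reduceEqDiff, Nat.cast_ofNat]
    refine ⟨?_, fun a ha => ?_, fun h1 => ?_, ?_, fun h2 => ?_⟩
    · simp [setNat_nat_of_ne, setReal_nat]
    · simp [setNat_real, setReal_real_of_ne _ ha]
    · simp [setNat_nat_of_ne, setNat_nat_self, setNat_real, setReal_real_self, h1]
    · simpa [setNat_nat_of_ne, setNat_nat_self] using hn
    · simpa [setNat_nat_of_ne, setNat_nat_self, setNat_real, setReal_real_self, setReal_nat]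
        using search_start h2 hx (by simp)
  · rintro τ ⟨hnat, hreal, h1, hq, hS⟩ hc
    have hτ := h.congr hnat hreal
    simp only [Test.holds, NExp.eval, cell, hτ.size] at hc
    have hS' := (hS (by omega)).push
    generalize hq' : τ.nat 2 0 = q at *
    have hcond : ∀ ρ : State, ∀ t : ℕ, ρ.nat 0 = σ.nat 0 → (∀ a, a ≠ 1 → ρ.real a = σ.real a) →
        ρ.nat 2 0 = q → ρ.nat 3 0 = τ.nat 3 0 + 1 → ρ.nat 5 0 = min (τ.nat 5 0) (n - 2 - q) →
        ρ.nat 4 = Function.update (τ.nat 4) (τ.nat 3 0 + 1) q → ρ.nat 1 0 = τ.nat 1 0 →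
        ρ.real 1 0 = τ.real 1 0 → t ≤ 500 →
        Halts (.seq searchLoop (.setN 2 (.const 0) (.add (cell 2) (.const 1)))) ρ
          fun τ' t' => I τ' ∧ t + t' + (5000 * (n - τ'.nat 2 0) +
            1200 * (τ'.nat 3 0 + τ'.nat 5 0)) ≤
            5000 * (n - q) + 1200 * (τ.nat 3 0 + τ.nat 5 0) := by
      intro ρ t g0 gr g2 g3 g5 g4 g1 gP gt
      rw [halts_seq]
      refine (halts_searchLoop hx (h.congr g0 gr) hc g2 (by omega) ?_).imp ?_
      · rw [gr 9 (by simp), gr 10 (by simp), g4, g3, g5, g1, gP]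
        exact hS'
      rintro τ' t' ⟨k1, k2, k3, k4⟩
      rw [halts_setN]
      have k20 : τ'.nat 2 0 = q := by rw [k1 2 (by simp) (by simp) (by simp), g2]
      refine ⟨⟨?_, fun a ha => ?_, by omega, ?_, fun _ => ?_⟩, ?_⟩
      · rw [setNat_nat_of_ne _ (by simp), k1 0 (by simp) (by simp) (by simp), g0]
      · rw [setNat_real, k2 a ha, gr a ha]
      · simp [setNat_nat_self, NExp.eval, cell, k20]
        omega
      · rw [gr 9 (by simp), gr 10 (by simp)] at k3
        simpa [setNat_nat_self, setNat_nat_of_ne, setNat_real, NExp.eval, cell, k20,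
          k1 4 (by simp) (by simp) (by simp)] using k3
      · simp only [setNat_nat_self, setNat_nat_of_ne, NExp.eval, cell, k20, NExp.cost, ne_eq,
          not_false_eq_true, Nat.reduceEqDiff, Function.update_self]
        omega
    rw [halts_seq, halts_setN, halts_seq, halts_setN, halts_seq, halts_cond]
    simp only [halts_setN, halts_skip, Test.holds, NExp.eval, cell, opposite, setNat_nat_self,
      setNat_nat_of_ne, hτ.size, hq', ne_eq, not_false_eq_true, Nat.reduceEqDiff,
      Function.update_self]
    refine ⟨fun hle => ?_, fun hle => ?_⟩
    · refine (hcond _ 500 ?_ ?_ ?_ ?_ ?_ ?_ ?_ ?_ le_rfl).imp fun τ' t' ht' => ⟨ht'.1, ?_⟩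
      · simp [setNat_nat_of_ne, hnat]
      · exact hreal
      · simp [setNat_nat_of_ne, hq']
      · simp [setNat_nat_self, setNat_nat_of_ne]
      · simp [setNat_nat_self, hle]
      · simp [setNat_nat_self, setNat_nat_of_ne]
      · simp [setNat_nat_of_ne]
      · rfl
      · have := ht'.2
        simp only [Test.cost, NExp.cost]
        omega
    · refine (hcond _ 500 ?_ ?_ ?_ ?_ ?_ ?_ ?_ ?_ le_rfl).imp fun τ' t' ht' => ⟨ht'.1, ?_⟩
      · simp [setNat_nat_of_ne, hnat]
      · exact hreal
      · simp [setNat_nat_of_ne, hq']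
      · simp [setNat_nat_self, setNat_nat_of_ne]
      · simp [setNat_nat_of_ne, (not_le.1 hle).le]
      · simp [setNat_nat_self, setNat_nat_of_ne]
      · simp [setNat_nat_of_ne]
      · rfl
      · have := ht'.2
        simp only [Test.cost, NExp.cost]
        omega
  · rintro τ t ⟨⟨hnat, hreal, h1, hq, hS⟩, hc, ht⟩
    have hτ := h.congr hnat hreal
    simp only [Test.holds, NExp.eval, cell, hτ.size] at hc
    refine ⟨hnat, hreal, h1, fun h2 => ?_, ?_⟩
    · have hS := hS h2
      have hle : ∀ q, q + 2 ≤ n → excess n x (τ.real 1 0) q ≤ 0 := fun q hq =>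
        hS.excess_nonpos q (by omega)
      have := hS.one_le
      have := hS.succ_le
      exact ⟨hS.one_le, hS.succ_le, le_antisymm (hle _ (by omega)) hS.excess_nonneg, hle⟩
    · simp only [Test.cost, NExp.cost, RExp.cost, cell, setNat_nat_self, setNat_nat_of_ne,
        setReal_nat, NExp.eval, h.size, ne_eq, not_false_eq_true, Nat.reduceEqDiff,
        Function.update_self] at ht ⊢
      omega

/-! ### Programs that write out the strategy -/

/-- Compute the regular strategy for the configuration in the array `X`. -/
def sweep (X B F S : ℕ) : Prog :=
  .seq (.setR S (.const 0) (.const 0)) <|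
  .seq (.setN 2 (.const 0) (.const 0)) <|
  .loop (.nle (.add (cell 2) (.const 1)) (cell 0)) <|
  .seq (.setR B (cell 2) (.get X (cell 2))) <|
  .seq (.cond
    (.and (.nle (.const 1) (cell 2)) (.rle (.get F (.sub (cell 2) (.const 1))) (.get X (cell 2))))
    (.setR B (cell 2) (.get F (.sub (cell 2) (.const 1)))) .skip) <|
  .seq (.setR F (cell 2) (.sub (.add (.mul (.const 2) (.get B (cell 2))) power)
    (.get X (cell 2)))) <|
  -- For agent `0` the truncated index reads the zero stored at the start, so the value at `i` is `i
  -- + 1` times the occupied length.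
  .seq (.setR S (cell 2) (.add (.get S (.sub (cell 2) (.const 1)))
    (.sub (.get 0 (.sub (cell 0) (.const 1))) (.get 0 (.const 0)))))
  (.setN 2 (.const 0) (.add (cell 2) (.const 1)))

theorem halts_sweep {σ : State} {X B F S n : ℕ} {x z : ℕ → ℝ} {P : ℝ} (hn : σ.nat 0 0 = n)
    (hx : σ.real 0 = x) (hX : ∀ i < n, σ.real X i = z i) (hP : σ.real 1 0 = P)
    (hBF : B ≠ F) (hBS : B ≠ S) (hFS : F ≠ S) (hXB : X ≠ B) (hXF : X ≠ F) (hXS : X ≠ S)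
    (h0B : 0 ≠ B) (h0F : 0 ≠ F) (h0S : 0 ≠ S) (h1B : 1 ≠ B) (h1F : 1 ≠ F) (h1S : 1 ≠ S) :
    Halts (sweep X B F S) σ fun τ t => (∀ a, a ≠ 2 → τ.nat a = σ.nat a) ∧
      (∀ a, a ≠ B → a ≠ F → a ≠ S → τ.real a = σ.real a) ∧
      (∀ i < n, τ.real B i = base z P i ∧ τ.real F i = reach z P i ∧
        τ.real S i = (i + 1) * (x (n - 1) - x 0)) ∧ t ≤ 500 * n + 500 := by
  let I : State → Prop := fun τ => (∀ a, a ≠ 2 → τ.nat a = σ.nat a) ∧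
    (∀ a, a ≠ B → a ≠ F → a ≠ S → τ.real a = σ.real a) ∧ τ.nat 2 0 ≤ n ∧
    (∀ j < τ.nat 2 0, τ.real B j = base z P j ∧ τ.real F j = reach z P j ∧
        τ.real S j = (j + 1) * (x (n - 1) - x 0)) ∧
    (τ.nat 2 0 = 0 → τ.real S 0 = 0)
  simp only [sweep, halts_seq, halts_setN, halts_setR]
  refine (halts_loop I (fun τ => 500 * (n - τ.nat 2 0)) ?_ ?_).imp ?_
  · refine ⟨fun a ha => ?_, fun a _ _ ha => ?_, ?_, fun j hj => ?_, fun _ => ?_⟩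
    · simp [setNat_nat_of_ne _ ha, setReal_nat]
    · simp [setNat_real, setReal_real_of_ne _ ha]
    · simp [setNat_nat_self, NExp.eval]
    · simp [setNat_nat_self, NExp.eval] at hj
    · simp [setNat_real, setReal_real_self, NExp.eval, RExp.eval]
  · rintro τ ⟨hnat, hreal, hi, hj, hS0⟩ hc
    have e0 : τ.nat 0 0 = n := by rw [hnat 0 (by simp), hn]
    have ex : τ.real 0 = x := by rw [hreal 0 h0B h0F h0S, hx]
    have eP : τ.real 1 0 = P := by rw [hreal 1 h1B h1F h1S, hP]
    have eX : τ.real X = σ.real X := hreal X hXB hXF hXS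
    simp only [Test.holds, cell, NExp.eval, e0] at hc
    generalize hi2 : τ.nat 2 0 = i at *
    have eXi := hX i (by omega)
    have cost : ∀ (w : ℝ) (ρ : State) (k : ℕ), w = base z P i → ρ.nat = τ.nat →
        (∀ a, a ≠ B → ρ.real a = τ.real a) → (∀ j < i, ρ.real B j = τ.real B j) →
        ρ.real B i = w → k ≤ 300 →
        I ((((ρ.setReal F i (2 * w + P - z i)).setReal S i
          (τ.real S (i - 1) + (x (n - 1) - x 0))).setNat 2 0 (i + 1))) ∧
        k + 500 * (n - (i + 1)) ≤ 500 * (n - i) := by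
      rintro _ ρ k rfl g1 g2 g3 g4 hk
      refine ⟨⟨fun a ha => ?_, fun a aB aF aS => ?_, ?_, ?_, ?_⟩, by omega⟩
      · simp [setNat_nat_of_ne _ ha, setReal_nat, g1, hnat a ha]
      · simp [setNat_real, setReal_real_of_ne, aF, aS, g2 a aB, hreal a aB aF aS]
      · simpa [setNat_nat_self] using hc
      · simp only [setNat_nat_self, Function.update_self, setNat_real, setReal_real_self,
          setReal_real_of_ne _ hFS, setReal_real_of_ne _ hBS, setReal_real_of_ne _ hBF,
          setReal_real_of_ne _ hFS.symm, g2 S hBS.symm, g2 F hBF.symm]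
        intro j hji
        rcases (by omega : j = i ∨ j < i) with rfl | hji
        · simp only [Function.update_self, g4, reach_eq_base, true_and]
          cases j with
          | zero => simp [hS0 rfl]
          | succ j =>
            rw [Nat.add_sub_cancel, (hj j (by omega)).2.2]
            push_cast
            ring
        · rw [Function.update_of_ne (by omega), Function.update_of_ne (by omega), g3 j hji]
          exact hj j hji
      · simp [setNat_nat_self]
    simp only [halts_seq, halts_setN, halts_setR, halts_cond, halts_skip, cell, NExp.eval,
      RExp.eval, Test.holds, power, hi2, e0, ex, eX, eXi, eP, setReal_nat, setNat_nat_self,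
      setReal_real_self, setReal_setReal, setReal_real_of_ne _ hBF.symm,
      setReal_real_of_ne _ hXB, setReal_real_of_ne _ h0B, setReal_real_of_ne _ h0F,
      setReal_real_of_ne _ h1B,
      setReal_real_of_ne _ hFS.symm, setReal_real_of_ne _ hBS.symm,
      Function.update_self, Nat.cast_ofNat]
    refine ⟨fun hle => ?_, fun hle => ?_⟩
    · obtain ⟨i, rfl⟩ : ∃ k, i = k + 1 := ⟨i - 1, by omega⟩
      have hb : τ.real F (i + 1 - 1) = base z P (i + 1) := by
        rw [Nat.add_sub_cancel, (hj i (by omega)).2.1] at *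
        exact (min_eq_left hle.2).symm
      refine cost _ (τ.setReal B (i + 1) (τ.real F (i + 1 - 1))) _ hb rfl
        (fun a ha => setReal_real_of_ne _ ha _ _) (fun j hji => ?_) ?_
        (by simp only [Test.cost, NExp.cost, RExp.cost]; omega)
      · rw [setReal_real_self, Function.update_of_ne (by omega)]
      · rw [setReal_real_self, Function.update_self]
    · have hb : z i = base z P i := by
        cases i with
        | zero => rfl
        | succ i =>
          rw [Nat.add_sub_cancel, (hj i (by omega)).2.1] at hle
          refine (min_eq_right (le_of_not_ge fun h => hle ⟨by omega, h⟩)).symm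
      refine cost _ (τ.setReal B i (z i)) _ hb rfl
        (fun a ha => setReal_real_of_ne _ ha _ _) (fun j hji => ?_) ?_
        (by simp only [Test.cost, NExp.cost, RExp.cost]; omega)
      · rw [setReal_real_self, Function.update_of_ne (by omega)]
      · rw [setReal_real_self, Function.update_self]
  · rintro τ t ⟨⟨hnat, hreal, hi, hj, -⟩, hc, ht⟩
    have e0 : τ.nat 0 0 = n := by rw [hnat 0 (by simp), hn]
    simp only [Test.holds, cell, NExp.eval, e0] at hc
    refine ⟨hnat, hreal, fun i hi => hj i (by omega), ?_⟩
    simp only [Test.cost, cell, NExp.cost, RExp.cost, setNat_nat_self, NExp.eval,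
      Function.update_self] at ht ⊢
    omega

/-- Replace the entries for the agents that move to the left by those for the reflected
configuration. -/
def combine : Prog :=
  .seq (.setN 2 (.const 0) (.const 0)) <|
  .loop (.nle (.add (cell 2) (.const 1)) (cell 0)) <|
  .seq (.cond (.nle (cell 1) (cell 2))
    (.seq (.setR 2 (cell 2)
      (.sub (.const 0) (.get 11 (.sub (.sub (cell 0) (.const 1)) (cell 2))))) <|
    .seq (.setR 4 (cell 2)
      (.sub (.const 0) (.get 13 (.sub (.sub (cell 0) (.const 1)) (cell 2)))))
    (.setR 3 (cell 2) (.get 12 (.sub (.sub (cell 0) (.const 1)) (cell 2))))) .skip)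
  (.setN 2 (.const 0) (.add (cell 2) (.const 1)))

theorem halts_combine {σ : State} {n : ℕ} (hn : σ.nat 0 0 = n) :
    Halts combine σ fun τ t => (∀ a, a ≠ 2 → τ.nat a = σ.nat a) ∧ τ.real 1 = σ.real 1 ∧
      (∀ i < n, τ.real 2 i = (if σ.nat 1 0 ≤ i then -σ.real 11 (n - 1 - i) else σ.real 2 i) ∧
        τ.real 4 i = (if σ.nat 1 0 ≤ i then -σ.real 13 (n - 1 - i) else σ.real 4 i) ∧
        τ.real 3 i = (if σ.nat 1 0 ≤ i then σ.real 12 (n - 1 - i) else σ.real 3 i)) ∧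
      t ≤ 500 * n + 500 := by
  let I : State → Prop := fun τ => (∀ a, a ≠ 2 → τ.nat a = σ.nat a) ∧
    (∀ a, a ≠ 2 → a ≠ 3 → a ≠ 4 → τ.real a = σ.real a) ∧ τ.nat 2 0 ≤ n ∧
    (∀ j, τ.real 2 j =
        (if j < τ.nat 2 0 ∧ σ.nat 1 0 ≤ j then -σ.real 11 (n - 1 - j) else σ.real 2 j) ∧
      τ.real 4 j =
        (if j < τ.nat 2 0 ∧ σ.nat 1 0 ≤ j then -σ.real 13 (n - 1 - j) else σ.real 4 j) ∧
      τ.real 3 j =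
        (if j < τ.nat 2 0 ∧ σ.nat 1 0 ≤ j then σ.real 12 (n - 1 - j) else σ.real 3 j))
  simp only [combine, halts_seq, halts_setN]
  refine (halts_loop I (fun τ => 500 * (n - τ.nat 2 0)) ?_ ?_).imp ?_
  · refine ⟨fun a ha => ?_, fun a _ _ ha => rfl, ?_, fun j => ?_⟩
    · simp [setNat_nat_of_ne _ ha]
    · simp [setNat_nat_self, NExp.eval]
    · simp [setNat_nat_self, NExp.eval, setNat_real]
  · rintro τ ⟨hnat, hreal, hi, hj⟩ hc
    have e0 : τ.nat 0 0 = n := by rw [hnat 0 (by simp), hn]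
    have e1 : τ.nat 1 0 = σ.nat 1 0 := by rw [hnat 1 (by simp)]
    simp only [Test.holds, cell, NExp.eval, e0] at hc
    generalize hi2 : τ.nat 2 0 = i at *
    simp only [halts_seq, halts_setN, halts_setR, halts_cond, halts_skip, cell, NExp.eval,
      RExp.eval, Test.holds, hi2, e0, e1, setReal_nat, setNat_nat_self, Function.update_self,
      setReal_real_of_ne, ne_eq, not_false_eq_true, Nat.reduceEqDiff, Nat.cast_zero, zero_sub,
      hreal 11 (by simp) (by simp) (by simp), hreal 12 (by simp) (by simp) (by simp),
      hreal 13 (by simp) (by simp) (by simp)]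
    refine ⟨fun hle => ⟨⟨fun a ha => ?_, fun a a2 a3 a4 => ?_, ?_, fun j => ?_⟩, ?_⟩,
      fun hle => ⟨⟨fun a ha => ?_, fun a a2 a3 a4 => ?_, ?_, fun j => ?_⟩, ?_⟩⟩
    · simp [setNat_nat_of_ne _ ha, setReal_nat, hnat a ha]
    · simp [setNat_real, setReal_real_of_ne, a2, a3, a4, hreal a]
    · simpa [setNat_nat_self] using hc
    · rcases eq_or_ne j i with rfl | hji
      · simp [setNat_real, setReal_real_of_ne, setReal_real_self, setNat_nat_self, hle]
      · have : j < i + 1 ↔ j < i := by omega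
        simpa [setNat_real, setReal_real_of_ne, setReal_real_self, setNat_nat_self, hji, this]
          using hj j
    · simp only [Test.cost, NExp.cost, RExp.cost]
      omega
    · simp [setNat_nat_of_ne _ ha, hnat a ha]
    · simp [setNat_real, a2, a3, a4, hreal a]
    · simpa [setNat_nat_self] using hc
    · have : (j < i + 1 ∧ σ.nat 1 0 ≤ j) ↔ (j < i ∧ σ.nat 1 0 ≤ j) := by omega
      simpa only [setNat_real, setNat_nat_self, Function.update_self, this] using hj j
    · simp only [Test.cost, NExp.cost]
      omega
  · rintro τ t ⟨⟨hnat, hreal, hi, hj⟩, hc, ht⟩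
    have e0 : τ.nat 0 0 = n := by rw [hnat 0 (by simp), hn]
    simp only [Test.holds, cell, NExp.eval, e0] at hc
    refine ⟨hnat, hreal 1 (by simp) (by simp) (by simp), fun i hin => ?_, ?_⟩
    · have : (i < τ.nat 2 0 ∧ σ.nat 1 0 ≤ i) ↔ σ.nat 1 0 ≤ i := by omega
      simpa only [this] using hj i
    · simp only [Test.cost, cell, NExp.cost, setNat_nat_self, NExp.eval,
        Function.update_self] at ht ⊢
      omega

/-! ### The whole algorithm -/

/-- Compute the optimal power and an optimal regular strategy. -/
def optimalConvergecast : Prog :=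
  .seq prepare <| .seq (thresholds 0 6 9) <| .seq (thresholds 7 8 10) <| .seq search <|
  .seq (sweep 0 2 4 3) <| .seq (sweep 7 11 13 12) combine

theorem halts_optimalConvergecast {σ : State} {n : ℕ} {x : ℕ → ℝ} (hn1 : 1 ≤ n)
    (hx : Increasing n x) (hn : σ.nat 0 0 = n) (hσ : σ.real 0 = x) (h6 : σ.real 6 0 = 0)
    (h8 : σ.real 8 0 = 0) :
    Halts optimalConvergecast σ fun τ t => t ≤ 30000 * n ∧ ∃ q < n, τ.nat 1 0 = q + 1 ∧
      (n = 1 → τ.real 1 0 = 0) ∧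
      (2 ≤ n → q + 2 ≤ n ∧ excess n x (τ.real 1 0) q = 0 ∧
        ∀ r, r + 2 ≤ n → excess n x (τ.real 1 0) r ≤ 0) ∧
      ∀ i < n,
        τ.real 2 i = (if i ≤ q then base x (τ.real 1 0) i
          else -base (mirror n x) (τ.real 1 0) (n - 1 - i)) ∧
        τ.real 4 i = (if i ≤ q then reach x (τ.real 1 0) i
          else -reach (mirror n x) (τ.real 1 0) (n - 1 - i)) ∧
        τ.real 3 i = ((if i ≤ q then i else n - 1 - i : ℕ) + 1) * (x (n - 1) - x 0) := by
  rw [optimalConvergecast, halts_seq]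
  refine (halts_prepare hn hσ h6 h8).imp ?_
  rintro σ₁ t₁ ⟨a1, a2, a3, a4, a5, a6, a7⟩
  have n1 : σ₁.nat 0 0 = n := by rw [a1 0 (by simp), hn]
  have x1 : σ₁.real 0 = x := by rw [a2 0 (by simp) (by simp) (by simp) (by simp), hσ]
  rw [halts_seq]
  refine (halts_thresholds hn1 hx n1 (by simp) (by simp) (by simp) (fun i _ => by rw [x1]) a5
    a3).imp ?_
  rintro σ₂ t₂ ⟨b1, b2, b3, b4⟩
  have n2 : σ₂.nat 0 0 = n := by rw [b1 0 (by simp) (by simp) (by simp), n1]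
  have x2 : σ₂.real 0 = x := by rw [b2 0 (by simp), x1]
  rw [← b2 7 (by simp)] at a4
  rw [← b2 8 (by simp)] at a6
  rw [← b2 5 (by simp)] at a3
  rw [← b2 6 (by simp)] at a5
  rw [halts_seq]
  refine (halts_thresholds hn1 hx.mirror n2 (by simp) (by simp) (by simp) a4 a6 a3).imp ?_
  rintro σ₃ t₃ ⟨c1, c2, c3, c4⟩
  have hR : Ready n x σ₃ := by
    refine ⟨by rw [c1 0 (by simp) (by simp) (by simp), n2], by rw [c2 0 (by simp), x2],
      ?_, ?_, ?_, ?_, ?_, c3⟩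
    · rwa [c2 5 (by simp)]
    · rwa [c2 7 (by simp)]
    · rwa [c2 6 (by simp)]
    · rwa [c2 8 (by simp)]
    · rwa [c2 9 (by simp)]
  rw [halts_seq]
  refine (halts_search hn1 hx hR).imp ?_
  rintro σ₄ t₄ ⟨d1, d2, d3, d4, d5⟩
  have hR := hR.congr d1 d2
  rw [halts_seq]
  refine (halts_sweep hR.size hR.conf (fun i _ => by rw [hR.conf]) rfl (by simp) (by simp) (by simp)
    (by simp) (by simp) (by simp) (by simp) (by simp) (by simp) (by simp) (by simp) (by simp)).imp ?_
  rintro σ₅ t₅ ⟨e1, e2, e3, e4⟩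
  have r1 : σ₅.real 1 0 = σ₄.real 1 0 := by rw [e2 1 (by simp) (by simp) (by simp)]
  rw [halts_seq]
  refine (halts_sweep (σ := σ₅) (X := 7) (B := 11) (F := 13) (S := 12)
    (by rw [e1 0 (by simp), hR.size]) (by rw [e2 0 (by simp) (by simp) (by simp), hR.conf])
    (by rw [e2 7 (by simp) (by simp) (by simp)]; exact hR.reflected) r1 (by simp) (by simp)
    (by simp) (by simp) (by simp) (by simp) (by simp) (by simp) (by simp) (by simp) (by simp)
    (by simp)).imp ?_
  rintro σ₆ t₆ ⟨f1, f2, f3, f4⟩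
  refine (halts_combine (by rw [f1 0 (by simp), e1 0 (by simp), hR.size])).imp ?_
  rintro τ t ⟨g1, g2, g3, g4⟩
  have p6 : σ₆.nat 1 0 = σ₄.nat 1 0 := by rw [f1 1 (by simp), e1 1 (by simp)]
  have pτ : τ.nat 1 0 = σ₄.nat 1 0 := by rw [g1 1 (by simp), p6]
  have rτ : τ.real 1 0 = σ₄.real 1 0 := by rw [g2, f2 1 (by simp) (by simp) (by simp), r1]
  have hp : 1 ≤ σ₄.nat 1 0 ∧ σ₄.nat 1 0 ≤ n := by
    rcases (by omega : n = 1 ∨ 2 ≤ n) with h | h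
    · have := (d3 h).1
      omega
    · have := d4 h
      omega
  -- The additive constants of the running times are absorbed because `1 ≤ n`.
  refine ⟨by omega, σ₄.nat 1 0 - 1, by omega, by omega, fun h => by rw [rτ, (d3 h).2],
    fun h => ?_, fun i hi => ?_⟩
  · obtain ⟨k1, k2, k3, k4⟩ := d4 h
    rw [rτ]
    exact ⟨by omega, k3, k4⟩
  · have hle : i ≤ σ₄.nat 1 0 - 1 ↔ ¬ σ₄.nat 1 0 ≤ i := by omega
    obtain ⟨k1, k2, k3⟩ := g3 i hi
    rw [p6] at k1 k2 k3
    rw [k1, k2, k3, rτ, (f3 _ (by omega)).1, (f3 _ (by omega)).2.1, (f3 _ (by omega)).2.2,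
      f2 2 (by simp) (by simp) (by simp), f2 3 (by simp) (by simp) (by simp),
      f2 4 (by simp) (by simp) (by simp), (e3 i hi).1, (e3 i hi).2.1, (e3 i hi).2.2]
    by_cases h : σ₄.nat 1 0 ≤ i
    · simp [hle, h]
    · simp [hle, h]

end RealRAM

theorem theorem1 :
    ∃ (q : RealRAM.Prog) (C : ℕ),
      ∀ (n : ℕ) (ℓ : ℝ) (pos : Fin n → ℝ), 1 ≤ n → StrictMono pos →
        (∀ i, pos i ∈ Set.Icc 0 ℓ) →
        ∃ (τ : RealRAM.State) (t : ℕ) (P : ℝ) (p : ℕ) (b s f : Fin n → ℝ),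
          RealRAM.Exec q (RealRAM.input pos) τ t ∧ t ≤ C * n ∧
          τ.HasOutput P p b s f ∧
          Convergecast.IsOptimalPower ℓ pos P ∧
          Convergecast.IsRegular pos P p b s f ∧
          Convergecast.IsConvergecast ℓ pos P (Convergecast.twoMoves b s f) := by
  refine ⟨RealRAM.optimalConvergecast, 30000, fun n ℓ pos hn hpos hℓ => ?_⟩
  have hx : ∀ i : Fin n, (RealRAM.input pos).real 0 i = pos i := fun i => by simp [RealRAM.input]
  have hinc : Convergecast.Increasing n ((RealRAM.input pos).real 0) := fun i j hij hj => by
    have := hpos (show (⟨i, hij.trans hj⟩ : Fin n) < ⟨j, hj⟩ from hij)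
    rwa [← hx, ← hx] at this
  obtain ⟨τ, t, hexec, ht, q, hqn, hq, h1, h2, hout⟩ :=
    RealRAM.halts_optimalConvergecast (σ := RealRAM.input pos) hn hinc (by simp [RealRAM.input])
      rfl (by simp [RealRAM.input]) (by simp [RealRAM.input])
  refine ⟨τ, t, τ.real 1 0, q + 1, fun i => τ.real 2 i, fun i => τ.real 3 i, fun i => τ.real 4 i,
    hexec, ht, ⟨rfl, hq, fun i => ⟨rfl, rfl, rfl⟩⟩, ?_⟩
  -- A single agent admits no split into two nonempty groups, so the excess says nothing about it.
  rcases (by omega : n = 1 ∨ 2 ≤ n) with rfl | hn2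
  · obtain rfl : q = 0 := by omega
    obtain ⟨k1, k2, k3⟩ := hout 0 hn
    have h0 : (RealRAM.input pos).real 0 0 = pos 0 := hx 0
    rw [h1 rfl] at *
    refine Convergecast.single_agent hℓ ?_ ?_ ?_
    · simpa [Convergecast.base, h0] using k1
    · simpa [Convergecast.reach, h0] using k2
    · simpa using k3
  · obtain ⟨hqn, h3, h4⟩ := h2 hn2
    have := Convergecast.isRegular_and_isConvergecast hpos hℓ hx hqn h3
      (fun i => (hout i i.2).1) (fun i => (hout i i.2).2.1) (fun i => (hout i i.2).2.2)
    exact ⟨Convergecast.isOptimalPower_of_excess hn2 hpos hx this.2 h4, this⟩
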